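/- Let $L_k$ be the language over $\{a,b\}$ of strings consisting of $k$ alternating nonempty blocks of $a$'s and $b$'s, starting with $a$: $L_k=(a^+b^+)^{k/2}$ for $k$ even and $L_k=(a^+b^+)^{(k-1)/2}a^+$ for $k$ odd. Let $L^e_k$ be the language over $\{a,b,e\}$ of strings that lie in $L_k$ after all letters $e$ are deleted. Fixed-precision numbers. For $p\ge 1$, $s\ge 0$ let $\mathbb F=\{m2^{-s} : m\in\mathbb Z,\ -2^{p-1}\le m<2^{p-1}\}$, and for real $x$ let $\mathrm{round}(x)$ be the greatest element of $\mathbb F$ that is $\le x$ (and $\min\mathbb F$ if there is none); vectors and matrices are rounded entrywise. Transformers. A (future-masked) fixed-precision transformer $T$ of depth $k$ over an alphabet $\Gamma$ is given by $p,s$, a dimension $d$, and arbitrary functions $E:\Gamma\to\mathbb F^d$, $W_Q^{(\ell)},W_K^{(\ell)},W_V^{(\ell)},f^{(\ell)}:\mathbb F^d\to\mathbb F^d$ ($1\le \ell\le k$) and $W_{\rm out}:\mathbb F^d\to\mathbb F$. On a nonempty input $w=w_1\cdots w_n$ it computes $h^{(0)}_i=E(w_i)$ and, for $\ell=1,\dots,k$,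 with $q_i,k_i,v_i$ the images of $h^{(\ell-1)}_i$ under $W_Q^{(\ell)},W_K^{(\ell)},W_V^{(\ell)}$ and scores $s_{ij}=q_i\cdot k_j$, $$c_i=\mathrm{round}\left(\frac{\sum_{j\le i}\mathrm{round}(\exp(s_{ij})\,v_j)}{\sum_{j\le i}\mathrm{round}(\exp(s_{ij}))}\right),\qquad h^{(\ell)}_i=f^{(\ell)}\big(\mathrm{round}(c_i+h^{(\ell-1)}_i)\big),$$ where $c_i$ is the rounded average of $v_1,\dots,v_i$ if the denominator is $0$; apart from the displayed roundings, the arithmetic is exact. $T$ accepts $w$ if $W_{\rm out}(h^{(k)}_n)>0$. A transformer over $\Sigma\cup\{\texttt{<BOS>}\}$ recognizes a language $L\subseteq\Sigma^*$ if for every $w\in\Sigma^*$ it accepts $\texttt{<BOS>}\cdot w$ if and only if $w\in L$. Position encodings. For $d$ even and a vector $\theta$ of $d/2$ angles, each a rational multiple of $\pi$, let $R(\theta)^i$ be the $d\times d$ block-diagonal matrix with blocks $\begin{pmatrix}\cos i\theta_c&-\sin i\theta_c\\ \sin i\theta_c&\cos i\theta_c\end{pmatrix}$, with its entries rounded to $\mathbb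 F$ (so that it is periodic in $i$). A transformer with sinusoidal position encoding uses, for some such $\theta$, $h_i^{(0)}=\mathrm{round}\big(E(w_i)+R(\theta)^{i-1}(0,1,0,1,\dots,0,1)^{\top}\big)$. A transformer with RoPE uses, for some such $\theta$, the scores $s_{ij}=R(\theta)^i q_i\cdot R(\theta)^j k_j$. A transformer with ALiBi uses, for some real $\alpha\ge 0$, the scores $s_{ij}=q_i\cdot k_j-\alpha\,(i-j)$. Theorem. Let $k\ge 0$. For each of the four kinds of fixed-precision transformer (without position encoding, with sinusoidal position encoding, with RoPE, with ALiBi): some depth-$(k+1)$ transformer of this kind recognizes $L^e_{k+1}$, and no depth-$k$ transformer of this kind does. -/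

import Mathlib

open scoped Matrix

namespace DepthHierarchy

/-! ## The languages -/

/-- The two-letter alphabet `Σ = {a, b}`. -/
inductive AB
  | a
  | b

/-- The alphabet `Σ ∪ {e}` with an extra neutral letter `e`. -/
inductive ABE
  | letter (x : AB)
  | e

/-- `L⁺ = L L*`. -/
def kleenePlus {α : Type} (L : Language α) : Language α := L * KStar.kstar L

/-- The language `a⁺`. -/
def aPlus : Language AB := kleenePlus {[AB.a]}

/-- The language `b⁺`. -/
def bPlus : Language AB := kleenePlus {[AB.b]}

/-- `altPlus k` is the language of strings with `k` alternating blocks of `a` and `b`,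
starting with `a`: it is `(a⁺b⁺)^(k/2)` for even `k` and `(a⁺b⁺)^((k-1)/2) a⁺` for odd `k`. -/
def altPlus (k : ℕ) : Language AB :=
  if Even k then (aPlus * bPlus) ^ (k / 2) else (aPlus * bPlus) ^ ((k - 1) / 2) * aPlus

/-- The string homomorphism that deletes all occurrences of `e`. -/
def del (w : List ABE) : List AB :=
  w.filterMap fun x => match x with
    | ABE.letter y => some y
    | ABE.e => none

/-- `altPlusNeutral k` is the inverse image of `altPlus k` under deletion of `e`. -/
def altPlusNeutral (k : ℕ) : Language ABE := {w | del w ∈ altPlus k}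

/-! ## Fixed-precision numbers -/

/-- Fixed-precision numbers with `p` total bits and `s` fractional bits, given by their
significand `num`: the number represented is `num * 2 ^ (-s)`. -/
@[ext]
structure Fixed (p s : ℕ) where
  num : ℤ
  lower : -2 ^ (p - 1) ≤ num
  upper : num < 2 ^ (p - 1)

/-- The real number represented by a fixed-precision number. -/
noncomputable def Fixed.val {p s : ℕ} (x : Fixed p s) : ℝ := (x.num : ℝ) / 2 ^ s

/-- Rounding down: `roundDown p s x` is the greatest fixed-precision number that is at most `x`
(see `roundDown_isGreatest`), and the least fixed-precision number if `x` is below all of them. -/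
noncomputable def roundDown (p s : ℕ) (x : ℝ) : Fixed p s where
  num := max (-2 ^ (p - 1)) (min ⌊x * 2 ^ s⌋ (2 ^ (p - 1) - 1))
  lower := le_max_left _ _
  upper := by
    have h : (0 : ℤ) < 2 ^ (p - 1) := by positivity
    exact max_lt (by omega) (lt_of_le_of_lt (min_le_right _ _) (by omega))

theorem roundDown_isGreatest (p s : ℕ) (x : ℝ) (hx : ∃ y : Fixed p s, y.val ≤ x) :
    IsGreatest {r : ℝ | (∃ y : Fixed p s, y.val = r) ∧ r ≤ x} (roundDown p s x).val := by
  have hs : (0 : ℝ) < 2 ^ s := by positivity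
  have key : ∀ y : Fixed p s, y.val ≤ x ↔ y.num ≤ ⌊x * 2 ^ s⌋ := by
    intro y
    rw [Int.le_floor, Fixed.val, div_le_iff₀ hs]
  obtain ⟨y, hy⟩ := hx
  rw [key] at hy
  have hlow := y.lower
  refine ⟨⟨⟨_, rfl⟩, (key _).2 ?_⟩, ?_⟩
  · exact max_le (hlow.trans hy) (min_le_left _ _)
  · rintro r ⟨⟨z, rfl⟩, hz⟩
    rw [key] at hz
    have hz' : z.num ≤ (roundDown p s x).num :=
      le_max_of_le_right (le_min hz (by have := z.upper; omega))
    unfold Fixed.val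
    gcongr

/-- The set `F^d` of vectors of fixed-precision numbers. -/
abbrev Vec (p s d : ℕ) : Type := Fin d → Fixed p s

/-- The real vector represented by a vector of fixed-precision numbers. -/
noncomputable def Vec.val {p s d : ℕ} (x : Vec p s d) : Fin d → ℝ := fun c => (x c).val

/-- Componentwise rounding. -/
noncomputable def roundVec (p s : ℕ) {d : ℕ} (x : Fin d → ℝ) : Vec p s d :=
  fun c => roundDown p s (x c)

/-! ## Position encodings -/

/-- The block-diagonal rotation matrix with blocks
`[[cos θ_c, -sin θ_c], [sin θ_c, cos θ_c]]` for `c = 0, …, d/2 - 1` (for even `d`; only these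
angles matter). -/
noncomputable def rotMatrix (d : ℕ) (θ : ℕ → ℝ) : Matrix (Fin d) (Fin d) ℝ :=
  Matrix.of fun r c =>
    if r.val / 2 = c.val / 2 then
      if r = c then Real.cos (θ (r.val / 2))
      else if r < c then -Real.sin (θ (r.val / 2))
      else Real.sin (θ (r.val / 2))
    else 0

/-- The matrix of the `i`-th power of the rotation, with entries rounded to fixed precision. -/
noncomputable def rotationPow (p s d : ℕ) (θ : ℕ → ℝ) (i : ℕ) : Matrix (Fin d) (Fin d) ℝ :=
  ((rotMatrix d θ) ^ i).map fun x => (roundDown p s x).val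

/-- The kinds of position encoding. -/
inductive PEKind
  | none
  | sinusoidal
  | rope
  | alibi

/-- Position encodings of each kind, in dimension `d`. The sinusoidal encoding and RoPE need an
even dimension and have angles that are rational multiples of `π`; ALiBi has a scaling factor
`α ≥ 0`. -/
inductive PosEnc (d : ℕ) : PEKind → Type
  | none : PosEnc d PEKind.none
  | sinusoidal (hd : Even d) (θ : ℕ → ℝ) (hθ : ∀ c, ∃ r : ℚ, θ c = r * Real.pi) :
      PosEnc d PEKind.sinusoidal
  | rope (hd : Even d) (θ : ℕ → ℝ) (hθ : ∀ c, ∃ r : ℚ, θ c = r * Real.pi) :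
      PosEnc d PEKind.rope
  | alibi (α : ℝ) (hα : 0 ≤ α) : PosEnc d PEKind.alibi

/-- The vector that is added to the word embedding at position `i` (positions are numbered from
`1`): for the sinusoidal encoding it is `R(θ)^(i-1) (sin 0, cos 0, …, sin 0, cos 0)`, for the
other kinds it is zero. -/
noncomputable def PosEnc.embedding {d : ℕ} {κ : PEKind} (p s : ℕ) (pe : PosEnc d κ) (i : ℕ) :
    Fin d → ℝ :=
  match pe with
  | .none => 0
  | .sinusoidal _ θ _ =>
      rotationPow p s d θ (i - 1) *ᵥ
        fun c => if Even c.val then Real.sin 0 else Real.cos 0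
  | .rope _ _ _ => 0
  | .alibi _ _ => 0

/-- The attention score of query vector `q` at position `i` and key vector `k` at position `j`
(positions are numbered from `1`). -/
noncomputable def PosEnc.score {d : ℕ} {κ : PEKind} (p s : ℕ) (pe : PosEnc d κ) (i j : ℕ)
    (q k : Fin d → ℝ) : ℝ :=
  match pe with
  | .none => q ⬝ᵥ k
  | .sinusoidal _ _ _ => q ⬝ᵥ k
  | .rope _ θ _ => (rotationPow p s d θ i *ᵥ q) ⬝ᵥ (rotationPow p s d θ j *ᵥ k)
  | .alibi α _ => q ⬝ᵥ k - α * ((i : ℝ) - (j : ℝ))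

/-! ## Transformers -/

/-- A future-masked fixed-precision transformer of depth `k` over the alphabet `Γ`, with
position encoding of kind `κ`. -/
structure Transformer (κ : PEKind) (Γ : Type) (k : ℕ) where
  /-- total number of bits -/
  p : ℕ
  p_pos : 0 < p
  /-- number of fractional bits -/
  s : ℕ
  /-- hidden dimension -/
  d : ℕ
  pe : PosEnc d κ
  E : Γ → Vec p s d
  WQ : Fin k → Vec p s d → Vec p s d
  WK : Fin k → Vec p s d → Vec p s d
  WV : Fin k → Vec p s d → Vec p s d
  f : Fin k → Vec p s d → Vec p s d
  Wout : Vec p s d → Fixed p s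

namespace Transformer

variable {κ : PEKind} {Γ : Type} {k : ℕ}

/-- Future-masked attention at (zero-based) index `i`, for given queries, keys and values at all
indices. Scores, exponentials, sums and the quotient are exact; the summands and the result are
rounded. If the denominator vanishes, the values at the unmasked indices are averaged. -/
noncomputable def attention (T : Transformer κ Γ k) {n : ℕ} (q key v : Fin n → Vec T.p T.s T.d)
    (i : Fin n) : Vec T.p T.s T.d :=
  let weight : Fin n → ℝ := fun j =>
    Real.exp (T.pe.score T.p T.s (i.val + 1) (j.val + 1) (q i).val (key j).val)
  let den : ℝ := ∑ j ∈ Finset.Iic i, (roundDown T.p T.s (weight j)).val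
  fun c =>
    roundDown T.p T.s
      (if den = 0 then (∑ j ∈ Finset.Iic i, (v j c).val) / ((i.val : ℝ) + 1)
       else (∑ j ∈ Finset.Iic i, (roundDown T.p T.s (weight j * (v j c).val)).val) / den)

/-- `T.hidden w ℓ h i` is the hidden vector after `ℓ` layers at (zero-based) index `i` of the
input `w`; that is, at position `i + 1`. -/
noncomputable def hidden (T : Transformer κ Γ k) (w : List Γ) :
    (ℓ : ℕ) → ℓ ≤ k → Fin w.length → Vec T.p T.s T.d
  | 0, _, i => roundVec T.p T.s ((T.E (w.get i)).val + T.pe.embedding T.p T.s (i.val + 1))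
  | ℓ + 1, h, i =>
      let x : Fin w.length → Vec T.p T.s T.d := T.hidden w ℓ (Nat.le_of_succ_le h)
      let c : Vec T.p T.s T.d :=
        T.attention (fun j => T.WQ ⟨ℓ, h⟩ (x j)) (fun j => T.WK ⟨ℓ, h⟩ (x j))
          (fun j => T.WV ⟨ℓ, h⟩ (x j)) i
      T.f ⟨ℓ, h⟩ (roundVec T.p T.s (c.val + (x i).val))

/-- The output of `T` on a nonempty string: the output function at the last position. -/
noncomputable def output (T : Transformer κ Γ k) (w : List Γ) (hw : w ≠ []) : Fixed T.p T.s :=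
  T.Wout (T.hidden w k le_rfl ⟨w.length - 1, Nat.sub_lt (List.length_pos_of_ne_nil hw) one_pos⟩)

/-- `T` accepts a nonempty string if its output is positive. -/
def Accepts (T : Transformer κ Γ k) (w : List Γ) (hw : w ≠ []) : Prop := 0 < (T.output w hw).val

end Transformer

/-- The alphabet `Γ` together with the beginning-of-string symbol. -/
inductive WithBOS (Γ : Type)
  | bos
  | sym (x : Γ)

/-- The transformer `T` recognizes the language `L` over `Γ` if, for all strings `w` over `Γ`,
it accepts `BOS · w` if and only if `w ∈ L`. -/
def Transformer.Recognizes {κ : PEKind} {Γ : Type} {k : ℕ} (T : Transformer κ (WithBOS Γ) k)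
    (L : Language Γ) : Prop :=
  ∀ w : List Γ, T.Accepts (WithBOS.bos :: w.map WithBOS.sym) (List.cons_ne_nil _ _) ↔ w ∈ L

end DepthHierarchy

namespace DepthHierarchy

/-! Both bounds are about counting blocks: membership means that the first letter is not `b` and
that the block count has the right value (`mem_altPlus_iff`).

Lower bound. A rounded attention value is determined by the signs of finitely many sums over the
positions so far, since it suffices to compare the numerator with `z` times the denominator for each
fixed-precision `z` (`attention_eq_decodeTests`). If the states of a layer depend only on the
letters, the next layer sees only signs of affine functionals of letter counts. Repeating a letter
drives every functional that gives it nonzero weight far from zero, and a functional with no nonzero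
weight is constant. So some `eᵐ xⁿ yˡ`, where `x` continues the current block and `y` opens the
next, freezes all signs against bounded continuations (`exists_block_signStable`). Each layer is
thus neutralized at the cost of one block (`exists_settled`), and some prefix with `k + 1` blocks
leaves `k` layers unable to tell a further `e` from the letter of a new block.

Position encodings are absorbed by padding every letter with `e`s to a fixed length. Sinusoidal
encodings and RoPE are periodic, and the padded length is a multiple of the period. Under ALiBi the
rounded summands become constant beyond some distance `D`; the direct influence of the last letter
spreads by at most `D` per layer and has died out at the end of its padding.

Upper bound. Rounding down turns uniform attention over values `-1` and `0` into an existence test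
(`floor_average_eq`). The first layer tests for `a` and for `b` and so counts up to two blocks; each
further layer counts one more, by looking for the letter of the next block at a position whose count
has reached the current cap. Hence `k + 1` layers separate `k + 1` blocks from `k + 2`. -/

/-! ## Membership in the alternating-block languages -/

/-- The letter of the `k`-th block of a string that starts with `a`. -/
def blockLetter (k : ℕ) : AB := if Odd k then AB.a else AB.b

/-- The effect of one letter on the number of blocks; leading `b`s are not counted. -/
def blockStep (q : ℕ) : AB → ℕ
  | AB.a => if Odd q then q else q + 1
  | AB.b => if Odd q then q + 1 else q

/-- The number of alternating blocks of a string, leading `b`s not counted. -/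
def blockCount (u : List AB) : ℕ := u.foldl blockStep 0

theorem blockCount_append_singleton (u : List AB) (x : AB) :
    blockCount (u ++ [x]) = blockStep (blockCount u) x := by
  simp [blockCount]

theorem blockStep_blockLetter_succ (q : ℕ) : blockStep q (blockLetter (q + 1)) = q + 1 := by
  by_cases h : Odd q <;> simp [blockStep, blockLetter, h, Nat.odd_add_one]

theorem blockStep_blockLetter (q : ℕ) : blockStep q (blockLetter q) = q := by
  by_cases h : Odd q <;> simp [blockStep, blockLetter, h]

theorem eq_blockLetter_or (q : ℕ) (x : AB) : x = blockLetter q ∨ x = blockLetter (q + 1) := by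
  by_cases h : Odd q <;> cases x <;> simp [blockLetter, h, Nat.odd_add_one]

theorem blockLetter_ne_succ (q : ℕ) : blockLetter q ≠ blockLetter (q + 1) := by
  by_cases h : Odd q <;> simp [blockLetter, h, Nat.odd_add_one]

theorem blockStep_le (q : ℕ) (x : AB) : q ≤ blockStep q x := by
  rcases eq_blockLetter_or q x with rfl | rfl
  · rw [blockStep_blockLetter]
  · rw [blockStep_blockLetter_succ]; omega

theorem mem_kleenePlus_singleton {α : Type} (x : α) (u : List α) :
    u ∈ kleenePlus {[x]} ↔ ∃ n, u = List.replicate (n + 1) x := by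
  unfold kleenePlus
  simp only [Language.mem_mul, Language.mem_kstar]
  constructor
  · rintro ⟨a, ha, b, ⟨L, rfl, hL⟩, rfl⟩
    refine ⟨L.length, ?_⟩
    have ha' : a = [x] := ha
    subst ha'
    have : L.flatten = List.replicate L.length x := by
      clear ha
      induction L with
      | nil => simp
      | cons y L ih =>
        have hy : y = [x] := hL y (by simp)
        subst hy
        rw [List.flatten_cons, ih fun z hz => hL z (by simp [hz])]
        simp [List.replicate_succ]
    rw [this]
    simp [List.replicate_succ]
  · rintro ⟨n, rfl⟩
    refine ⟨[x], rfl, List.replicate n x, ⟨List.replicate n [x], ?_, ?_⟩, ?_⟩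
    · induction n with
      | zero => simp
      | succ n ih => simp [List.replicate_succ, ← ih]
    · intro y hy
      exact (List.mem_replicate.1 hy).2
    · simp [List.replicate_succ]

theorem altPlus_zero : altPlus 0 = 1 := by
  simp [altPlus]

theorem altPlus_succ (k : ℕ) :
    altPlus (k + 1) = altPlus k * kleenePlus {[blockLetter (k + 1)]} := by
  rcases Nat.even_or_odd' k with ⟨m, rfl | rfl⟩
  · simp [altPlus, blockLetter, aPlus]
  · have h1 : (2 * m + 1 + 1) / 2 = m + 1 := by omega
    have h2 : Even (2 * m + 1 + 1) := ⟨m + 1, by omega⟩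
    have h3 : ¬ Odd (2 * m + 1 + 1) := Nat.not_odd_iff_even.2 h2
    simp [altPlus, blockLetter, h1, h2, h3, pow_succ, mul_assoc, bPlus]

theorem append_singleton_mem_altPlus_succ (u : List AB) (x : AB) (k : ℕ) :
    u ++ [x] ∈ altPlus (k + 1) ↔
      x = blockLetter (k + 1) ∧ (u ∈ altPlus k ∨ u ∈ altPlus (k + 1)) := by
  rw [altPlus_succ]
  simp only [Language.mem_mul, mem_kleenePlus_singleton]
  constructor
  · rintro ⟨a, ha, b, ⟨n, rfl⟩, h⟩
    rw [List.replicate_succ', ← List.append_assoc] at h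
    obtain ⟨h1, h2⟩ := List.append_inj' h rfl
    refine ⟨by simpa using h2.symm, ?_⟩
    cases n with
    | zero => left; simpa [← h1] using ha
    | succ n => right; exact ⟨a, ha, _, ⟨n, rfl⟩, h1⟩
  · rintro ⟨rfl, h | ⟨a, ha, b, ⟨n, rfl⟩, rfl⟩⟩
    · exact ⟨u, h, _, ⟨0, rfl⟩, rfl⟩
    · exact ⟨a, ha, _, ⟨n + 1, rfl⟩, by simp [List.replicate_succ']⟩

theorem nil_notMem_altPlus_succ (k : ℕ) : [] ∉ altPlus (k + 1) := by
  rw [altPlus_succ]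
  simp only [Language.mem_mul, mem_kleenePlus_singleton]
  rintro ⟨a, ha, b, ⟨n, rfl⟩, h⟩
  simp at h

theorem blockCount_pos_of_head {u : List AB} (h : u.head? = some AB.a) : 0 < blockCount u := by
  induction u using List.reverseRecOn with
  | nil => simp at h
  | append_singleton u x ih =>
    rw [blockCount_append_singleton]
    cases u with
    | nil =>
      simp only [List.nil_append, List.head?_cons, Option.some.injEq] at h
      subst h
      simp [blockStep, blockCount]
    | cons y u => exact (ih (by simpa using h)).trans_le (blockStep_le _ _)

/-- Induction on the last letter, which either prolongs the last block or opens it. The head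
condition compensates for `blockCount` ignoring leading `b`s. -/
theorem mem_altPlus_iff (u : List AB) (k : ℕ) :
    u ∈ altPlus k ↔ blockCount u = k ∧ u.head? ≠ some AB.b := by
  induction u using List.reverseRecOn generalizing k with
  | nil =>
    cases k with
    | zero => simp [altPlus_zero, blockCount, Language.mem_one]
    | succ k => simp [nil_notMem_altPlus_succ, blockCount]
  | append_singleton u x ih =>
    have hhead : (u ++ [x]).head? ≠ some AB.b → u.head? ≠ some AB.b := by
      cases u <;> simp
    rw [blockCount_append_singleton]
    cases k with
    | zero =>
      simp only [altPlus_zero, Language.mem_one, List.append_eq_nil_iff, List.cons_ne_self,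
        and_false, false_iff, not_and, not_not]
      intro h
      by_contra hne
      have : (u ++ [x]).head? = some AB.a := by
        cases hu : (u ++ [x]).head? with
        | none => simp at hu
        | some y => cases y with
          | a => rfl
          | b => exact absurd hu hne
      have := blockCount_pos_of_head this
      rw [blockCount_append_singleton] at this
      omega
    | succ k =>
      rw [append_singleton_mem_altPlus_succ, ih, ih]
      constructor
      · rintro ⟨rfl, ⟨h1, h2⟩ | ⟨h1, h2⟩⟩
        · rw [h1, blockStep_blockLetter_succ]
          refine ⟨rfl, ?_⟩
          cases u with
          | nil =>
            subst h1
            simp [blockLetter, blockCount]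
          | cons y u => simpa using h2
        · rw [h1, blockStep_blockLetter]
          refine ⟨rfl, ?_⟩
          cases u with
          | nil => simp [blockCount] at h1
          | cons y u => simpa using h2
      · rintro ⟨h1, h2⟩
        have h3 := hhead h2
        rcases eq_blockLetter_or (blockCount u) x with rfl | rfl
        · rw [blockStep_blockLetter] at h1
          exact ⟨by rw [h1], Or.inr ⟨h1, h3⟩⟩
        · rw [blockStep_blockLetter_succ] at h1
          exact ⟨by rw [h1], Or.inl ⟨by omega, h3⟩⟩

theorem mem_altPlusNeutral_iff (w : List ABE) (k : ℕ) :
    w ∈ altPlusNeutral k ↔ blockCount (del w) = k ∧ (del w).head? ≠ some AB.b :=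
  mem_altPlus_iff _ _

theorem del_append (u v : List ABE) : del (u ++ v) = del u ++ del v := by
  simp [del]

/-! ## Stabilizing the signs of linear functionals of letter counts -/

/-- Adding the weights of at most `N` letters to `o` does not change its sign. -/
def SignStable {σ : Type} (N : ℕ) (o : ℝ) (wt : σ → ℝ) : Prop :=
  ∀ v : List σ, v.length ≤ N → (0 ≤ o + (v.map wt).sum ↔ 0 ≤ o)

/-- Part of the allowance is spent on `u` and the rest remains, so stability won early survives the
letters appended later. -/
theorem SignStable.append {σ : Type} {M N : ℕ} {o : ℝ} {wt : σ → ℝ}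
    (h : SignStable (M + N) o wt) {u : List σ} (hu : u.length ≤ M) :
    SignStable N (o + (u.map wt).sum) wt := by
  intro v hv
  rw [h u (by omega), ← h (u ++ v) (by simp; omega)]
  simp [add_assoc]

theorem abs_sum_map_le {σ : Type} {wt : σ → ℝ} {C : ℝ} (hC : ∀ x, |wt x| ≤ C) (v : List σ) :
    |(v.map wt).sum| ≤ v.length * C := by
  induction v with
  | nil => simp
  | cons x v ih =>
    have := abs_add_le (wt x) (v.map wt).sum
    have := hC x
    simp only [List.map_cons, List.sum_cons, List.length_cons, Nat.cast_add, Nat.cast_one]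
    linarith

theorem signStable_of_lt_abs {σ : Type} {wt : σ → ℝ} {C o : ℝ} {N : ℕ} (hC : ∀ x, |wt x| ≤ C)
    (hC0 : 0 ≤ C) (ho : N * C < |o|) : SignStable N o wt := by
  intro v hv
  have h1 := abs_sum_map_le hC v
  have h2 : (v.length : ℝ) * C ≤ N * C := by gcongr
  have h3 := abs_le.1 (h1.trans h2)
  rcases le_or_gt 0 o with h | h
  · rw [abs_of_nonneg h] at ho
    exact ⟨fun _ => h, fun _ => by linarith⟩
  · rw [abs_of_neg h] at ho
    exact ⟨fun _ => by linarith, fun _ => by linarith⟩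

/-- Repeating one letter a bounded number of times stabilizes all functionals that give this
letter a nonzero weight; the bound does not depend on the starting values. -/
theorem exists_replicate_signStable {A σ : Type} [Finite A] [Finite σ] (wt : A → σ → ℝ) (z : σ)
    (N : ℕ) :
    ∃ B : ℕ, ∀ o : A → ℝ, ∃ n, 1 ≤ n ∧ n ≤ B ∧ ∀ a, wt a z ≠ 0 →
      SignStable N (o a + ((List.replicate n z).map (wt a)).sum) (wt a) := by
  classical
  cases nonempty_fintype A
  obtain ⟨C₀, hC₀⟩ := Finite.exists_le fun q : A × σ => |wt q.1 q.2|
  set C := max C₀ 0 with hCdef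
  have hC : ∀ a x, |wt a x| ≤ C := fun a x => (hC₀ (a, x)).trans (le_max_left _ _)
  have hC0 : 0 ≤ C := le_max_right _ _
  -- `W` further letters move each relevant functional by more than `2 * (N * C)`, the width of the
  -- zone around zero where stability may fail.
  obtain ⟨W, hW⟩ := Finite.exists_le fun a : A => ⌈2 * (N * C) / |wt a z|⌉₊ + 1
  have hsep : ∀ a, wt a z ≠ 0 → 2 * (N * C) < W * |wt a z| := by
    intro a ha
    have hpos : 0 < |wt a z| := abs_pos.2 ha
    have h1 : (2 * (N * C) / |wt a z|) ≤ ⌈2 * (N * C) / |wt a z|⌉₊ := Nat.le_ceil _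
    have h2 : ((⌈2 * (N * C) / |wt a z|⌉₊ + 1 : ℕ) : ℝ) ≤ W := by exact_mod_cast hW a
    push_cast at h2
    rw [← div_lt_iff₀ hpos]
    linarith
  -- The candidates are `1 + m * W` with `m ≤ card A`. Each functional spoils at most one of them,
  -- and there are more candidates than functionals, whatever `o` is.
  refine ⟨1 + Fintype.card A * W, fun o => ?_⟩
  by_contra hcon
  push Not at hcon
  have hbad : ∀ m : Fin (Fintype.card A + 1), ∃ a, wt a z ≠ 0 ∧
      |o a + ((1 + m.val * W : ℕ) : ℝ) * wt a z| ≤ N * C := by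
    intro m
    have hm : m.val ≤ Fintype.card A := Nat.lt_succ_iff.1 m.isLt
    obtain ⟨a, ha, hns⟩ := hcon (1 + m.val * W) (by omega) (by gcongr)
    refine ⟨a, ha, ?_⟩
    by_contra hlt
    push Not at hlt
    apply hns
    rw [List.map_replicate, List.sum_replicate, nsmul_eq_mul]
    exact signStable_of_lt_abs (hC a) hC0 hlt
  choose F hF using hbad
  obtain ⟨m, m', hne, heq⟩ := Fintype.exists_ne_map_eq_of_card_lt F (by simp)
  wlog hlt : m < m' generalizing m m'
  · exact this m' m hne.symm heq.symm (lt_of_le_of_ne (not_lt.1 hlt) hne.symm)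
  have h1 := (hF m).2
  have h2 := (hF m').2
  have h3 := hsep _ (hF m).1
  rw [← heq] at h2
  have h4 : (m.val : ℝ) + 1 ≤ m'.val := by exact_mod_cast hlt
  have h5 : |(m'.val - m.val : ℝ) * W * wt (F m) z| ≤ 2 * (N * C) := by
    have := abs_sub (o (F m) + ((1 + m'.val * W : ℕ) : ℝ) * wt (F m) z)
      (o (F m) + ((1 + m.val * W : ℕ) : ℝ) * wt (F m) z)
    have e : (o (F m) + ((1 + m'.val * W : ℕ) : ℝ) * wt (F m) z) -
      (o (F m) + ((1 + m.val * W : ℕ) : ℝ) * wt (F m) z) =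
      (m'.val - m.val : ℝ) * W * wt (F m) z := by push_cast; ring
    rw [e] at this
    linarith
  rw [mul_assoc, abs_mul, abs_mul, abs_of_nonneg (by linarith : (0 : ℝ) ≤ m'.val - m.val),
    abs_of_nonneg (by positivity : (0 : ℝ) ≤ W)] at h5
  have h6 : 1 * ((W : ℝ) * |wt (F m) z|) ≤ (m'.val - m.val : ℝ) * (W * |wt (F m) z|) := by
    gcongr; linarith
  linarith

instance : Finite ABE :=
  Finite.of_injective (β := Fin 3)
    (fun x => match x with
      | ABE.letter AB.a => 0
      | ABE.letter AB.b => 1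
      | ABE.e => 2) (by
    intro x y h
    rcases x with ⟨_ | _⟩ | _ <;> rcases y with ⟨_ | _⟩ | _ <;> simp_all)

/-- A string `eᵐ xⁿ yˡ` of bounded length that stabilizes all functionals. -/
theorem exists_block_signStable {A : Type} [Finite A] (wt : A → ABE → ℝ) (x y : AB) (hxy : x ≠ y)
    (N : ℕ) :
    ∃ B : ℕ, ∀ o : A → ℝ, ∃ m n l, 1 ≤ l ∧ m + n + l ≤ B ∧ ∀ a,
      SignStable N (o a + ((List.replicate m ABE.e ++ List.replicate n (ABE.letter x) ++
        List.replicate l (ABE.letter y)).map (wt a)).sum) (wt a) := by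
  -- Bounds are fixed from the last letter backwards: what an earlier letter stabilizes must
  -- withstand all later repetitions and `N` more letters.
  obtain ⟨B₃, h₃⟩ := exists_replicate_signStable wt (ABE.letter y) N
  obtain ⟨B₂, h₂⟩ := exists_replicate_signStable wt (ABE.letter x) (B₃ + N)
  obtain ⟨B₁, h₁⟩ := exists_replicate_signStable wt ABE.e (B₂ + (B₃ + N))
  refine ⟨B₁ + B₂ + B₃, fun o => ?_⟩
  obtain ⟨m, -, hm, H₁⟩ := h₁ o
  obtain ⟨n, -, hn, H₂⟩ := h₂ fun a => o a + ((List.replicate m ABE.e).map (wt a)).sum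
  obtain ⟨l, hl, hl', H₃⟩ := h₃ fun a => o a + ((List.replicate m ABE.e).map (wt a)).sum +
    ((List.replicate n (ABE.letter x)).map (wt a)).sum
  refine ⟨m, n, l, hl, by omega, fun a => ?_⟩
  rw [List.map_append, List.map_append, List.sum_append, List.sum_append, ← add_assoc, ← add_assoc]
  by_cases hy : wt a (ABE.letter y) = 0
  · by_cases hx : wt a (ABE.letter x) = 0
    · by_cases he : wt a ABE.e = 0
      · have h0 : ∀ z, wt a z = 0 := by
          rintro (z | _)
          · cases x <;> cases y <;> cases z <;> simp_all
          · exact he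
        have hz : wt a = fun _ => 0 := funext h0
        intro v _
        simp [hz]
      · exact ((H₁ a he).append (by simpa using hn)).append (by simpa using hl')
    · exact (H₂ a hx).append (by simpa using hl')
  · exact H₃ a hy

/-! ## Threshold machines -/

/-- An abstract layered computation on infinite strings: the state of a position in the next layer
is determined by its current state and the signs of sums over the positions up to it. -/
structure ThresholdMachine (Γ H ι : Type) where
  init : ℕ → Γ → H
  score : ℕ → ι → ℕ → ℕ → H → H → ℝ
  update : ℕ → H → (ι → Prop) → H

namespace ThresholdMachine

variable {Γ H ι : Type}

/-- The state of position `i` after `ℓ` layers. -/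
def run (T : ThresholdMachine Γ H ι) (w : ℕ → Γ) : ℕ → ℕ → H
  | 0, i => T.init i (w i)
  | ℓ + 1, i => T.update ℓ (T.run w ℓ i) fun t =>
      0 ≤ ∑ j ∈ Finset.range (i + 1), T.score ℓ t i j (T.run w ℓ i) (T.run w ℓ j)

theorem run_congr (T : ThresholdMachine Γ H ι) {w w' : ℕ → Γ} (ℓ : ℕ) {i : ℕ}
    (h : ∀ j ≤ i, w j = w' j) : T.run w ℓ i = T.run w' ℓ i := by
  induction ℓ generalizing i with
  | zero => simp [run, h i le_rfl]
  | succ ℓ ih =>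
    simp only [run]
    rw [ih h]
    congr 1
    funext t
    congr 1
    refine Finset.sum_congr rfl fun j hj => ?_
    have : j ≤ i := Nat.lt_succ_iff.1 (Finset.mem_range.1 hj)
    rw [ih fun j' hj' => h j' (hj'.trans this)]

/-- The machine is periodic with period `P`, and scores at distance at least `D` depend on the
positions only through their residues. -/
structure IsPeriodic (T : ThresholdMachine Γ H ι) (P D : ℕ) : Prop where
  init_add : ∀ c i x, T.init (i + P * c) x = T.init i x
  score_shift : ∀ c ℓ t i j h h', T.score ℓ t (i + P * c) (j + P * c) h h' = T.score ℓ t i j h h'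
  score_far : ∀ c ℓ t i j h h', j + D ≤ i → T.score ℓ t (i + P * c) j h h' = T.score ℓ t i j h h'

theorem IsPeriodic.mul {T : ThresholdMachine Γ H ι} {P D : ℕ} (hT : T.IsPeriodic P D) (Q : ℕ) :
    T.IsPeriodic (P * Q) D where
  init_add c i x := by rw [mul_assoc, hT.init_add]
  score_shift c ℓ t i j h h' := by rw [mul_assoc, hT.score_shift]
  score_far c ℓ t i j h h' hij := by rw [mul_assoc, hT.score_far _ _ _ _ _ _ _ hij]

end ThresholdMachine

/-! ### Padded strings and sums over their blocks -/

/-- The infinite string in which every letter of `BOS · L` is followed by `M - 1` letters `e`. -/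
def padded (M : ℕ) (L : List ABE) (n : ℕ) : WithBOS ABE :=
  if n % M = 0 then (WithBOS.bos :: L.map WithBOS.sym).getD (n / M) (WithBOS.sym ABE.e)
  else WithBOS.sym ABE.e

theorem padded_append {M : ℕ} (L L' : List ABE) {n : ℕ} (hn : n < (L.length + 1) * M) :
    padded M (L ++ L') n = padded M L n := by
  have : n / M < L.length + 1 := Nat.div_lt_of_lt_mul (by rwa [mul_comm])
  unfold padded
  split_ifs with h
  · rw [List.map_append, ← List.cons_append, List.getD_append]
    simpa using this
  · rfl

theorem padded_last {M : ℕ} (L : List ABE) (x : ABE) (r : Fin M) :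
    padded M (L ++ [x]) ((L.length + 1) * M + r) =
      if r.val = 0 then WithBOS.sym x else WithBOS.sym ABE.e := by
  have hM : 0 < M := r.pos
  have h1 : ((L.length + 1) * M + r.val) % M = r.val := by
    rw [Nat.mul_add_mod_self_right, Nat.mod_eq_of_lt r.isLt]
  have h2 : ((L.length + 1) * M + r.val) / M = L.length + 1 := by
    rw [add_comm, Nat.add_mul_div_right _ _ hM, Nat.div_eq_of_lt r.isLt, zero_add]
  simp [padded, h1, h2]

theorem sum_range_block (f : ℕ → ℝ) (M a b c : ℕ) :
    ∑ j ∈ Finset.range ((a + b) * M + c), f j =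
      ∑ j ∈ Finset.range (a * M), f j +
      ∑ i ∈ Finset.range b, ∑ r : Fin M, f ((a + i) * M + r) +
      ∑ r ∈ Finset.range c, f ((a + b) * M + r) := by
  rw [Finset.sum_range_add]
  congr 1
  induction b with
  | zero => simp
  | succ b ih =>
    rw [Finset.sum_range_succ, ← add_assoc (Finset.sum _ _), ← ih, ← add_assoc a, Nat.succ_mul,
      Finset.sum_range_add]
    simp [Finset.sum_range]

theorem sum_map_eq_sum_range {α : Type} (v : List α) (f : α → ℝ) (d : α) :
    (v.map f).sum = ∑ i ∈ Finset.range v.length, f (v.getD i d) := by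
  induction v using List.reverseRecOn with
  | nil => simp
  | append_singleton v x ih =>
    rw [List.map_append, List.sum_append, ih, List.length_append, List.length_singleton,
      Finset.sum_range_succ]
    congr 1
    · refine Finset.sum_congr rfl fun i hi => ?_
      rw [List.getD_append _ _ _ _ (Finset.mem_range.1 hi)]
    · simp

/-! ### Settling the layers one by one -/

namespace ThresholdMachine

variable {H ι : Type}

/-- On all continuations of the padded string `p` by at most `N` padded letters, the state of a
position after `ℓ` layers is determined by the last of these letters and the offset. -/
def Settled (T : ThresholdMachine (WithBOS ABE) H ι) (M ℓ : ℕ) (p : List ABE) (N : ℕ)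
    (τ : ABE → Fin M → H) : Prop :=
  ∀ v : List ABE, v.length ≤ N → ∀ x (r : Fin M),
    T.run (padded M (p ++ v ++ [x])) ℓ ((p.length + v.length + 1) * M + r) = τ x r

/-- The contribution of a padded letter `x` that is far to the left. -/
noncomputable def farWeight (T : ThresholdMachine (WithBOS ABE) H ι) {M : ℕ} (ℓ : ℕ) (t : ι)
    (τ : ABE → Fin M → H) (y : ABE) (r : Fin M) (x : ABE) : ℝ :=
  ∑ r' : Fin M, T.score ℓ t (r + M * 2) r' (τ y r) (τ x r')

/-- The contribution of the current padded letter up to the current offset. -/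
noncomputable def ownWeight (T : ThresholdMachine (WithBOS ABE) H ι) {M : ℕ} (ℓ : ℕ) (t : ι)
    (τ : ABE → Fin M → H) (y : ABE) (r : Fin M) : ℝ :=
  ∑ r' ∈ Finset.Iic r, T.score ℓ t r r' (τ y r) (τ y r')

/-- The contribution of the fixed prefix, the current padded letter, and the correction due to
the vicinity of the last padded letter. -/
noncomputable def offset (T : ThresholdMachine (WithBOS ABE) H ι) {M : ℕ} (ℓ : ℕ) (t : ι)
    (τ : ABE → Fin M → H) (p : List ABE) (y : ABE) (r : Fin M) : ℝ :=
  ∑ j ∈ Finset.range ((p.length + 1) * M),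
      T.score ℓ t ((p.length + 2) * M + r) j (τ y r) (T.run (padded M p) ℓ j) +
    ∑ r' : Fin M, (T.score ℓ t (r + M * 1) r' (τ y r) (τ ABE.e r') -
      T.score ℓ t (r + M * 2) r' (τ y r) (τ ABE.e r')) +
    T.ownWeight ℓ t τ y r

variable {T : ThresholdMachine (WithBOS ABE) H ι} {M D ℓ : ℕ}

/-- Apart from the current padded letter, only the preceding one can lie within distance `D`. Its
offsets up to `ℓ * D` are still far, because `M ≥ (ℓ + 1) * D`, and its later offsets have states
independent of the letter. So the near correction is the same for all letters and can be computed
with `e`. -/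
theorem score_last_block (hT : T.IsPeriodic M D) (hD : (ℓ + 1) * D ≤ M) {τ : ABE → Fin M → H}
    (htail : ∀ x y r, ℓ * D < r.val → τ x r = τ y r) (t : ι) (y x : ABE) (r r' : Fin M) :
    T.score ℓ t (r + M * 1) r' (τ y r) (τ x r') =
      T.score ℓ t (r + M * 2) r' (τ y r) (τ x r') +
      (T.score ℓ t (r + M * 1) r' (τ y r) (τ ABE.e r') -
      T.score ℓ t (r + M * 2) r' (τ y r) (τ ABE.e r')) := by
  rcases le_or_gt r'.val (ℓ * D) with h | h
  · have key : ∀ h', T.score ℓ t (r + M * 2) r' (τ y r) h' = T.score ℓ t (r + M * 1) r' (τ y r) h' := by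
      intro h'
      have := hT.score_far 1 ℓ t (r + M * 1) r' (τ y r) h' (by rw [Nat.succ_mul] at hD; omega)
      rw [← this]
      congr 1
      ring
    rw [key, key]; ring
  · rw [htail x ABE.e r' h]; ring

/-- Each letter of `v` contributes an amount that depends on that letter alone, so the tested sum is
an affine functional of the letter counts of `v`. The condition `v ≠ []` keeps the whole prefix at
distance at least `D`. -/
theorem sum_score_eq (hT : T.IsPeriodic M D) (hD : (ℓ + 1) * D ≤ M) {p : List ABE} {N : ℕ}
    {τ : ABE → Fin M → H} (hset : T.Settled M ℓ p N τ)
    (htail : ∀ x y r, ℓ * D < r.val → τ x r = τ y r) (t : ι) {v : List ABE} (hv : v ≠ [])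
    (hvN : v.length ≤ N) (x : ABE) (r : Fin M) :
    let n := (p.length + v.length + 1) * M + r
    let w := padded M (p ++ v ++ [x])
    ∑ j ∈ Finset.range (n + 1), T.score ℓ t n j (T.run w ℓ n) (T.run w ℓ j) =
      T.offset ℓ t τ p x r + (v.map (T.farWeight ℓ t τ x r)).sum := by
  intro n w
  have hD1 : D ≤ M := by nlinarith
  have hown : T.run w ℓ n = τ x r := hset v hvN x r
  have hmpos : 0 < v.length := List.length_pos_of_ne_nil hv
  have hsplit : n + 1 = ((p.length + 1) + v.length) * M + (r.val + 1) := by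
    simp only [n]; ring
  rw [hown, hsplit, sum_range_block]
  -- the prefix
  have hpre : ∀ j ∈ Finset.range ((p.length + 1) * M),
      T.score ℓ t n j (τ x r) (T.run w ℓ j) =
      T.score ℓ t ((p.length + 2) * M + r) j (τ x r) (T.run (padded M p) ℓ j) := by
    intro j hj
    have hj := Finset.mem_range.1 hj
    have hr : T.run w ℓ j = T.run (padded M p) ℓ j := T.run_congr ℓ fun j' hj' => by
      simp only [w]
      rw [List.append_assoc, padded_append _ _ (by omega)]
    have hn : n = ((p.length + 2) * M + r) + M * (v.length - 1) := by
      obtain ⟨m, hm⟩ : ∃ m, v.length = m + 1 := ⟨v.length - 1, by omega⟩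
      simp only [n, hm, Nat.add_sub_cancel]; ring
    rw [hr, hn, hT.score_far]
    have : (p.length + 2) * M = (p.length + 1) * M + M := by ring
    omega
  -- the current letter
  have hcur : ∑ r' ∈ Finset.range (r.val + 1), T.score ℓ t n ((p.length + 1 + v.length) * M + r')
      (τ x r) (T.run w ℓ ((p.length + 1 + v.length) * M + r')) = T.ownWeight ℓ t τ x r := by
    unfold ownWeight
    rw [Nat.range_succ_eq_Iic, ← Fin.map_valEmbedding_Iic, Finset.sum_map]
    refine Finset.sum_congr rfl fun r' hr' => ?_
    have e1 : n = r + M * (p.length + v.length + 1) := by simp only [n]; ring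
    have e2 : (p.length + 1 + v.length) * M + r'.val = r' + M * (p.length + v.length + 1) := by ring
    have e3 : T.run w ℓ ((p.length + 1 + v.length) * M + r'.val) = τ x r' := by
      rw [← hset v hvN x r', add_right_comm]
    simp only [Fin.valEmbedding_apply]
    rw [e3, e2, e1, hT.score_shift]
  -- the intermediate letters
  have hmid : ∀ i ∈ Finset.range v.length,
      ∑ r' : Fin M, T.score ℓ t n ((p.length + 1 + i) * M + r') (τ x r)
        (T.run w ℓ ((p.length + 1 + i) * M + r')) =
      ∑ r' : Fin M, T.score ℓ t (r + M * (v.length - i)) r' (τ x r) (τ (v.getD i ABE.e) r') := by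
    intro i hi
    have hi := Finset.mem_range.1 hi
    refine Finset.sum_congr rfl fun r' _ => ?_
    have e3 : T.run w ℓ ((p.length + 1 + i) * M + r'.val) = τ (v.getD i ABE.e) r' := by
      rw [← hset (v.take i) (by simp; omega) (v.getD i ABE.e) r']
      have hlen : p.length + (v.take i).length + 1 = p.length + 1 + i := by simp; omega
      rw [hlen]
      refine T.run_congr ℓ fun j hj => ?_
      have hvi : v = v.take i ++ [v.getD i ABE.e] ++ v.drop (i + 1) := by
        rw [List.getD_eq_getElem _ _ hi, List.append_assoc, List.singleton_append,
          List.getElem_cons_drop, List.take_append_drop]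
      have : p ++ v ++ [x] =
          (p ++ v.take i ++ [v.getD i ABE.e]) ++ (v.drop (i + 1) ++ [x]) := by
        conv_lhs => rw [hvi]
        simp only [List.append_assoc]
      simp only [w]
      rw [this, padded_append]
      have hl : (p ++ v.take i ++ [v.getD i ABE.e]).length = p.length + 1 + i := by simp; omega
      rw [hl, Nat.succ_mul]
      omega
    have e1 : n = (r + M * (v.length - i)) + M * (p.length + 1 + i) := by
      obtain ⟨m, hm⟩ : ∃ m, v.length = m + i := ⟨v.length - i, by omega⟩
      simp only [n, hm, Nat.add_sub_cancel]; ring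
    have e2 : (p.length + 1 + i) * M + r'.val = r' + M * (p.length + 1 + i) := by ring
    rw [e3, e2, e1, hT.score_shift]
  rw [hcur, Finset.sum_congr rfl hpre, Finset.sum_congr rfl hmid, sum_map_eq_sum_range _ _ ABE.e]
  obtain ⟨m, hm⟩ : ∃ m, v.length = m + 1 := ⟨v.length - 1, by omega⟩
  rw [hm, Finset.sum_range_succ, Finset.sum_range_succ]
  have hfar : ∀ i ∈ Finset.range m,
      ∑ r' : Fin M, T.score ℓ t (r + M * (m + 1 - i)) r' (τ x r) (τ (v.getD i ABE.e) r') =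
      T.farWeight ℓ t τ x r (v.getD i ABE.e) := by
    intro i hi
    have hi := Finset.mem_range.1 hi
    refine Finset.sum_congr rfl fun r' _ => ?_
    have e : r.val + M * (m + 1 - i) = (r + M * 2) + M * (m - 1 - i) := by
      obtain ⟨c, rfl⟩ : ∃ c, m = c + 1 + i := ⟨m - 1 - i, by omega⟩
      have h1 : c + 1 + i + 1 - i = c + 2 := by omega
      have h2 : c + 1 + i - 1 - i = c := by omega
      rw [h1, h2]; ring
    rw [e, hT.score_far]
    have := r'.isLt
    omega
  have hlast : ∑ r' : Fin M, T.score ℓ t (r + M * (m + 1 - m)) r' (τ x r)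
      (τ (v.getD m ABE.e) r') = T.farWeight ℓ t τ x r (v.getD m ABE.e) +
      ∑ r' : Fin M, (T.score ℓ t (r + M * 1) r' (τ x r) (τ ABE.e r') -
      T.score ℓ t (r + M * 2) r' (τ x r) (τ ABE.e r')) := by
    rw [farWeight, ← Finset.sum_add_distrib, Nat.add_sub_cancel_left]
    exact Finset.sum_congr rfl fun r' _ => score_last_block hT hD htail t x _ r r'
  rw [Finset.sum_congr rfl hfar, hlast, offset]
  ring

/-- At offsets far from the current letter, this letter acts like the preceding ones. -/
theorem offset_add_farWeight (hT : T.IsPeriodic M D) {τ : ABE → Fin M → H}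
    (htail : ∀ x y r, ℓ * D < r.val → τ x r = τ y r) (t : ι) (p : List ABE) (x y : ABE) {r : Fin M}
    (hr : (ℓ + 1) * D < r.val) :
    T.offset ℓ t τ p x r + T.farWeight ℓ t τ x r y =
      T.offset ℓ t τ p y r + T.farWeight ℓ t τ x r x := by
  have hr' : ℓ * D < r.val := lt_of_le_of_lt (by gcongr; omega) hr
  have hxy : τ y r = τ x r := htail _ _ _ hr'
  have key : T.ownWeight ℓ t τ x r - T.ownWeight ℓ t τ y r =
      T.farWeight ℓ t τ x r x - T.farWeight ℓ t τ x r y := by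
    unfold ownWeight farWeight
    rw [hxy, ← Finset.sum_sub_distrib, ← Finset.sum_sub_distrib]
    -- Extending the sum past `r` is harmless: there the states do not depend on the letter, so the
    -- added differences vanish.
    rw [Finset.sum_subset (Finset.subset_univ (Finset.Iic r))]
    · refine Finset.sum_congr rfl fun r' _ => ?_
      rcases le_or_gt r'.val (ℓ * D) with h | h
      · have h1 : r'.val + D ≤ r.val := by rw [Nat.succ_mul] at hr; omega
        rw [hT.score_far _ _ _ _ _ _ _ h1, hT.score_far _ _ _ _ _ _ _ h1]
      · rw [htail x y r' h, sub_self, sub_self]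
    · intro r' _ hr2
      have : r < r' := by simpa using hr2
      rw [htail x y r' (hr'.trans this), sub_self]
  unfold offset
  rw [hxy]
  linarith

/-- One more layer can be settled at the cost of one more block. -/
theorem exists_settled_succ [Finite H] [Finite ι] (hT : T.IsPeriodic M D) (hD : (ℓ + 1) * D ≤ M)
    (x y : AB) (hxy : x ≠ y) (N : ℕ) :
    ∃ N' : ℕ, ∀ (p : List ABE) (τ : ABE → Fin M → H), T.Settled M ℓ p N' τ →
      (∀ x y r, ℓ * D < r.val → τ x r = τ y r) →
      ∃ (m n l : ℕ) (τ' : ABE → Fin M → H), 1 ≤ l ∧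
        T.Settled M (ℓ + 1) (p ++ (List.replicate m ABE.e ++ List.replicate n (ABE.letter x) ++
        List.replicate l (ABE.letter y))) N τ' ∧
        ∀ x y r, (ℓ + 1) * D < r.val → τ' x r = τ' y r := by
  -- The prefix and its `τ` come only after `N'`, so the functionals range over all of the finitely
  -- many `τ`, and `B` must not depend on the offsets. The allowance `N + 1` leaves room for one
  -- letter in the exchange argument below, even if `N = 0`.
  obtain ⟨B, hB⟩ := exists_block_signStable
    (fun a : (ABE → Fin M → H) × ι × ABE × Fin M => T.farWeight ℓ a.2.1 a.1 a.2.2.1 a.2.2.2)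
    x y hxy (N + 1)
  refine ⟨B + N, fun p τ hset htail => ?_⟩
  obtain ⟨m, n, l, hl, hB', hstab⟩ := hB fun a => T.offset ℓ a.2.1 a.1 p a.2.2.1 a.2.2.2
  set u := List.replicate m ABE.e ++ List.replicate n (ABE.letter x) ++
        List.replicate l (ABE.letter y) with hu
  have hulen : u.length = m + n + l := by simp [hu]; ring
  have hu0 : u ≠ [] := by rw [← List.length_pos_iff]; omega
  refine ⟨m, n, l, fun z r => T.update ℓ (τ z r) fun t =>
    0 ≤ T.offset ℓ t τ p z r + (u.map (T.farWeight ℓ t τ z r)).sum, hl, ?_, ?_⟩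
  · intro v hv z r
    have hlen : (p ++ u).length + v.length + 1 = p.length + (u ++ v).length + 1 := by
      simp; ring
    have hrun := hset (u ++ v) (by simp; omega) z r
    rw [hlen, List.append_assoc p u v, run, hrun]
    congr 1
    funext t
    have hs := sum_score_eq hT hD hset htail t (v := u ++ v) (by simp [hu0]) (by simp; omega) z r
    simp only [hrun] at hs
    rw [hs, List.map_append, List.sum_append, ← add_assoc]
    exact propext (hstab (τ, t, z, r) v (by omega))
  · intro z z' r hr
    have hr' : ℓ * D < r.val := lt_of_le_of_lt (by gcongr; omega) hr
    have hzz : τ z' r = τ z r := htail _ _ _ hr'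
    simp only [hzz]
    congr 1
    funext t
    have hfw : T.farWeight ℓ t τ z' r = T.farWeight ℓ t τ z r := by
      unfold farWeight; rw [hzz]
    -- Adding the other letter as a far one changes neither sign, and the two enlarged sums agree by
    -- `offset_add_farWeight`.
    have h1 := hstab (τ, t, z, r) [z'] (by simp)
    have h2 := hstab (τ, t, z', r) [z] (by simp)
    have h3 := offset_add_farWeight hT htail t p z z' hr
    simp only [List.map_cons, List.map_nil, List.sum_cons, List.sum_nil, add_zero] at h1 h2
    rw [hfw] at h2
    rw [hfw, ← h1, ← h2]
    apply propext
    constructor <;> intro h <;> linarith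

theorem settled_zero (hT : T.IsPeriodic M D) (p : List ABE) (N : ℕ) :
    T.Settled M 0 p N fun x r => T.init r (if r.val = 0 then WithBOS.sym x else WithBOS.sym ABE.e) := by
  intro v _ x r
  have h := padded_last (p ++ v) x r
  rw [List.length_append] at h
  have e : (p.length + v.length + 1) * M + r.val = r + M * (p.length + v.length + 1) := by ring
  rw [run, h, e, hT.init_add]

theorem blockCount_append_replicate (u : List AB) (n : ℕ) :
    blockCount (u ++ List.replicate n (blockLetter (blockCount u))) = blockCount u := by
  induction n with
  | zero => simp
  | succ n ih =>
    rw [List.replicate_succ', ← List.append_assoc, blockCount_append_singleton, ih,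
      blockStep_blockLetter]

theorem blockCount_append_replicate_succ (u : List AB) (n : ℕ) :
    blockCount (u ++ List.replicate (n + 1) (blockLetter (blockCount u + 1))) =
      blockCount u + 1 := by
  have h : blockCount (u ++ [blockLetter (blockCount u + 1)]) = blockCount u + 1 := by
    rw [blockCount_append_singleton, blockStep_blockLetter_succ]
  have := blockCount_append_replicate (u ++ [blockLetter (blockCount u + 1)]) n
  rwa [h, List.append_assoc, List.singleton_append, ← List.replicate_succ] at this

theorem del_replicate_letter (n : ℕ) (x : AB) :
    del (List.replicate n (ABE.letter x)) = List.replicate n x := by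
  induction n with
  | zero => rfl
  | succ n ih => simp [List.replicate_succ, del]

theorem del_replicate_e (n : ℕ) : del (List.replicate n ABE.e) = [] := by
  induction n with
  | zero => rfl
  | succ n ih => simp [List.replicate_succ, del]

/-- A string with `ℓ + 1` blocks after which `ℓ` layers are settled. -/
theorem exists_settled [Finite H] [Finite ι] (hT : T.IsPeriodic M D) (ℓ : ℕ) (hD : ℓ * D ≤ M)
    (N : ℕ) :
    ∃ (p : List ABE) (τ : ABE → Fin M → H), blockCount (del p) = ℓ + 1 ∧
      (del p).head? = some AB.a ∧ T.Settled M ℓ p N τ ∧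
      ∀ x y r, ℓ * D < r.val → τ x r = τ y r := by
  induction ℓ generalizing N with
  | zero =>
    refine ⟨[ABE.letter AB.a], _, by simp [del, blockCount, blockStep], rfl,
      settled_zero hT _ N, ?_⟩
    intro x y r hr
    have : r.val ≠ 0 := by omega
    simp [this]
  | succ ℓ ih =>
    obtain ⟨N', hN'⟩ := exists_settled_succ hT hD (blockLetter (ℓ + 1)) (blockLetter (ℓ + 2))
      (blockLetter_ne_succ _) N
    obtain ⟨p, τ, hcount, hhead, hset, htail⟩ := ih (by nlinarith) N'
    obtain ⟨m, n, l, τ', hl, hset', htail'⟩ := hN' p τ hset htail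
    refine ⟨_, τ', ?_, ?_, hset', htail'⟩
    -- The repetitions of the current letter add no block; `l ≥ 1` ensures that the next letter adds
    -- exactly one.
    · obtain ⟨l, rfl⟩ : ∃ l', l = l' + 1 := ⟨l - 1, by omega⟩
      rw [del_append, del_append, del_append, del_replicate_e, del_replicate_letter,
        del_replicate_letter, List.nil_append, ← List.append_assoc]
      have h1 := blockCount_append_replicate (del p) n
      rw [hcount] at h1
      have h2 := blockCount_append_replicate_succ
        (del p ++ List.replicate n (blockLetter (ℓ + 1))) l
      rw [h1] at h2
      exact h2
    · rw [del_append, List.head?_append, hhead]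
      rfl

end ThresholdMachine

/-! ## Periodicity of position encodings -/

theorem rotMatrix_mul {d : ℕ} (hd : Even d) (θ φ : ℕ → ℝ) :
    rotMatrix d θ * rotMatrix d φ = rotMatrix d (fun c => θ c + φ c) := by
  ext r c
  obtain ⟨m, hm⟩ := hd
  have hr := r.isLt
  have h0 : 2 * (r.val / 2) < d := by omega
  have h1 : 2 * (r.val / 2) + 1 < d := by omega
  rw [Matrix.mul_apply, Finset.sum_eq_add (⟨2 * (r.val / 2), h0⟩ : Fin d) ⟨2 * (r.val / 2) + 1, h1⟩]
  · have e0 : 2 * (r.val / 2) / 2 = r.val / 2 := by omega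
    have e1 : (2 * (r.val / 2) + 1) / 2 = r.val / 2 := by omega
    simp only [rotMatrix, Matrix.of_apply, e0, e1, if_true]
    by_cases hc : r.val / 2 = c.val / 2
    · simp only [hc, if_true, Fin.ext_iff, Fin.lt_def, Real.cos_add, Real.sin_add]
      rcases Nat.mod_two_eq_zero_or_one r.val with hr2 | hr2 <;>
      rcases Nat.mod_two_eq_zero_or_one c.val with hc2 | hc2
      · have a1 : r.val = 2 * (c.val / 2) := by omega
        have a2 : c.val = 2 * (c.val / 2) := by omega
        generalize c.val / 2 = q at *
        rw [a1, a2]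
        simp [sub_eq_add_neg]
      · have a1 : r.val = 2 * (c.val / 2) := by omega
        have a2 : c.val = 2 * (c.val / 2) + 1 := by omega
        generalize c.val / 2 = q at *
        rw [a1, a2]
        simp
      · have a1 : r.val = 2 * (c.val / 2) + 1 := by omega
        have a2 : c.val = 2 * (c.val / 2) := by omega
        generalize c.val / 2 = q at *
        rw [a1, a2]
        simp
      · have a1 : r.val = 2 * (c.val / 2) + 1 := by omega
        have a2 : c.val = 2 * (c.val / 2) + 1 := by omega
        generalize c.val / 2 = q at *
        rw [a1, a2]
        simp
        ring
    · simp [hc]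
  · simp [Fin.ext_iff]
  · rintro j - ⟨hj0, hj1⟩
    have : r.val / 2 ≠ j.val / 2 := by
      simp only [ne_eq, Fin.ext_iff] at hj0 hj1
      omega
    simp [rotMatrix, this]
  · simp
  · simp

theorem rotMatrix_zero (d : ℕ) : rotMatrix d (fun _ => 0) = 1 := by
  ext r c
  by_cases h : r = c
  · subst h; simp [rotMatrix]
  · simp [rotMatrix, h]

theorem rotMatrix_pow {d : ℕ} (hd : Even d) (θ : ℕ → ℝ) (i : ℕ) :
    rotMatrix d θ ^ i = rotMatrix d (fun c => i * θ c) := by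
  induction i with
  | zero => simp [rotMatrix_zero]
  | succ i ih =>
    rw [pow_succ, ih, rotMatrix_mul hd]
    congr 1
    funext c
    push_cast
    ring

theorem rotMatrix_congr {d : ℕ} {θ φ : ℕ → ℝ}
    (hc : ∀ c < d, Real.cos (θ c) = Real.cos (φ c)) (hs : ∀ c < d, Real.sin (θ c) = Real.sin (φ c)) :
    rotMatrix d θ = rotMatrix d φ := by
  ext r c
  have h : r.val / 2 < d := by have := r.isLt; omega
  simp [rotMatrix, hc _ h, hs _ h]

theorem exists_rotMatrix_pow_eq_one {d : ℕ} (hd : Even d) (θ : ℕ → ℝ)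
    (hθ : ∀ c, ∃ r : ℚ, θ c = r * Real.pi) : ∃ P : ℕ, 0 < P ∧ rotMatrix d θ ^ P = 1 := by
  choose q hq using hθ
  refine ⟨2 * ∏ c ∈ Finset.range d, (q c).den,
    Nat.mul_pos two_pos (Finset.prod_pos fun c _ => (q c).pos), ?_⟩
  rw [rotMatrix_pow hd, ← rotMatrix_zero]
  have key : ∀ c < d, ∃ z : ℤ,
      ((2 * ∏ c ∈ Finset.range d, (q c).den : ℕ) : ℝ) * θ c = 0 + z * (2 * Real.pi) := by
    intro c hc
    obtain ⟨m, hm⟩ := Finset.dvd_prod_of_mem (fun c => (q c).den) (Finset.mem_range.2 hc)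
    have hden : ((q c : ℚ) : ℝ) * ((q c).den : ℝ) = ((q c).num : ℝ) := by
      exact_mod_cast Rat.mul_den_eq_num (q c)
    refine ⟨(q c).num * m, ?_⟩
    rw [hm, hq]
    push_cast
    rw [← hden]
    ring
  apply rotMatrix_congr
  · intro c hc
    obtain ⟨z, hz⟩ := key c hc
    rw [hz, Real.cos_add_int_mul_two_pi]
  · intro c hc
    obtain ⟨z, hz⟩ := key c hc
    rw [hz, Real.sin_add_int_mul_two_pi]

/-- Rounding follows the exact power, so the period of the exact rotation carries over. -/
theorem exists_rotationPow_periodic {d : ℕ} (hd : Even d) (θ : ℕ → ℝ)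
    (hθ : ∀ c, ∃ r : ℚ, θ c = r * Real.pi) :
    ∃ P : ℕ, 0 < P ∧ ∀ p s i c, rotationPow p s d θ (i + P * c) = rotationPow p s d θ i := by
  obtain ⟨P, hP, h⟩ := exists_rotMatrix_pow_eq_one hd θ hθ
  refine ⟨P, hP, fun p s i c => ?_⟩
  rw [rotationPow, pow_add, pow_mul, h, one_pow, mul_one, rotationPow]

/-! ## Rounding -/

instance (p s : ℕ) : Finite (Fixed p s) :=
  Finite.of_injective (β := Set.Ico (-2 ^ (p - 1) : ℤ) (2 ^ (p - 1)))
    (fun x => ⟨x.num, x.lower, x.upper⟩) (by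
    intro x y h
    ext
    exact congrArg Subtype.val h)

theorem val_le_iff {p s : ℕ} (y : Fixed p s) (x : ℝ) : y.val ≤ x ↔ y.num ≤ ⌊x * 2 ^ s⌋ := by
  rw [Int.le_floor, Fixed.val, div_le_iff₀ (by positivity)]

/-- Rounding depends only on the cut made in the finite set of fixed-precision numbers, also when
that cut is empty. This reduces a layer to finitely many comparisons. -/
theorem roundDown_congr {p s : ℕ} {x x' : ℝ}
    (h : ∀ y : Fixed p s, y.val ≤ x ↔ y.val ≤ x') : roundDown p s x = roundDown p s x' := by
  simp only [val_le_iff] at h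
  have hpos : (0 : ℤ) < 2 ^ (p - 1) := by positivity
  ext
  simp only [roundDown]
  have key : ∀ m : ℤ, -2 ^ (p - 1) ≤ m → m ≤ 2 ^ (p - 1) - 1 →
      (m ≤ ⌊x * 2 ^ s⌋ ↔ m ≤ ⌊x' * 2 ^ s⌋) := fun m h1 h2 => h ⟨m, h1, by omega⟩
  generalize ⌊x * 2 ^ s⌋ = a at *
  generalize ⌊x' * 2 ^ s⌋ = b at *
  generalize (2 : ℤ) ^ (p - 1) = K at *
  have ha := key (max (-K) (min a (K - 1)))
  have hb := key (max (-K) (min b (K - 1)))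
  omega

open Classical in
/-- The rounded value of a real number with the given lower bounds among the fixed-precision
numbers. -/
noncomputable def decodeCut (p s : ℕ) (P : Fixed p s → Prop) : Fixed p s :=
  if h : ∃ x : ℝ, ∀ y, P y ↔ y.val ≤ x then roundDown p s h.choose else roundDown p s 0

theorem decodeCut_eq {p s : ℕ} {P : Fixed p s → Prop} {x : ℝ} (h : ∀ y, P y ↔ y.val ≤ x) :
    decodeCut p s P = roundDown p s x := by
  have hex : ∃ x : ℝ, ∀ y, P y ↔ y.val ≤ x := ⟨x, h⟩
  rw [decodeCut, dif_pos hex]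
  exact roundDown_congr fun y => by rw [← hex.choose_spec, h]

/-- For `α > 0` the products tend to zero without changing sign, so the floors settle at `0` if `v ≥
0` and at `-1` if `v < 0`. Distant positions may thus keep contributing, but by a constant. -/
theorem exists_eventually_roundDown_exp_mul_eq (p s : ℕ) {α : ℝ} (hα : 0 ≤ α) (x v : ℝ) :
    ∃ y : Fixed p s, ∀ᶠ m : ℕ in Filter.atTop, roundDown p s (Real.exp (x - α * m) * v) = y := by
  rcases hα.eq_or_lt with rfl | hα
  · exact ⟨roundDown p s (Real.exp x * v), by simp⟩
  have hlim : Filter.Tendsto (fun m : ℕ => Real.exp (x - α * m) * v * 2 ^ s) Filter.atTop (nhds 0) := by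
    have h1 : Filter.Tendsto (fun m : ℕ => x - α * (m : ℝ)) Filter.atTop Filter.atBot := by
      simp only [sub_eq_add_neg]
      exact Filter.tendsto_atBot_add_const_left _ _ (Filter.tendsto_neg_atTop_atBot.comp
        (tendsto_natCast_atTop_atTop.const_mul_atTop hα))
    have h2 := ((Real.tendsto_exp_atBot.comp h1).mul_const v).mul_const (2 ^ s)
    simpa using h2
  have hfl : ∃ z : ℤ, ∀ᶠ m : ℕ in Filter.atTop, ⌊Real.exp (x - α * m) * v * 2 ^ s⌋ = z := by
    rcases le_or_gt 0 v with hv | hv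
    · refine ⟨0, ?_⟩
      filter_upwards [hlim.eventually (gt_mem_nhds one_pos)] with m hm
      rw [Int.floor_eq_iff]
      simp only [Int.cast_zero, zero_add]
      exact ⟨by positivity, hm⟩
    · refine ⟨-1, ?_⟩
      filter_upwards [hlim.eventually (lt_mem_nhds (by norm_num : (-1 : ℝ) < 0))] with m hm
      rw [Int.floor_eq_iff]
      push_cast
      refine ⟨hm.le, ?_⟩
      have : Real.exp (x - α * m) * v * 2 ^ s < 0 :=
        mul_neg_of_neg_of_pos (mul_neg_of_pos_of_neg (Real.exp_pos _) hv) (by positivity)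
      linarith
  obtain ⟨z, hz⟩ := hfl
  refine ⟨⟨max (-2 ^ (p - 1)) (min z (2 ^ (p - 1) - 1)), le_max_left _ _, ?_⟩, ?_⟩
  · have h : (0 : ℤ) < 2 ^ (p - 1) := by positivity
    omega
  · filter_upwards [hz] with m hm
    ext
    simp only [roundDown, hm]

/-- Contributions to attention sums are periodic in the positions, up to short-range effects. -/
theorem exists_roundDown_exp_score_periodic {κ : PEKind} {d : ℕ} (p s : ℕ) (pe : PosEnc d κ) :
    ∃ P D : ℕ, 0 < P ∧
      (∀ c i, roundVec p s ∘ (· + pe.embedding p s (i + P * c + 1)) =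
        roundVec p s ∘ (· + pe.embedding p s (i + 1))) ∧
      (∀ c i j q k, pe.score p s (i + P * c + 1) (j + P * c + 1) q k =
        pe.score p s (i + 1) (j + 1) q k) ∧
      (∀ (q k : Vec p s d) c i j, j + D ≤ i →
        (∀ v : Fixed p s,
          roundDown p s (Real.exp (pe.score p s (i + P * c + 1) (j + 1) q.val k.val) * v.val) =
          roundDown p s (Real.exp (pe.score p s (i + 1) (j + 1) q.val k.val) * v.val)) ∧
        roundDown p s (Real.exp (pe.score p s (i + P * c + 1) (j + 1) q.val k.val)) =
        roundDown p s (Real.exp (pe.score p s (i + 1) (j + 1) q.val k.val))) := by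
  cases pe with
  | none => exact ⟨1, 0, one_pos, fun _ _ => rfl, fun _ _ _ _ _ => rfl,
      fun _ _ _ _ _ _ => ⟨fun _ => rfl, rfl⟩⟩
  | sinusoidal hd θ hθ =>
    obtain ⟨P, hP, h⟩ := exists_rotationPow_periodic hd θ hθ
    exact ⟨P, 0, hP, fun c i => by simp [PosEnc.embedding, h], fun _ _ _ _ _ => rfl,
      fun _ _ _ _ _ _ => ⟨fun _ => rfl, rfl⟩⟩
  | rope hd θ hθ =>
    obtain ⟨P, hP, h⟩ := exists_rotationPow_periodic hd θ hθ
    refine ⟨P, 0, hP, fun c i => rfl, fun c i j q k => ?_, fun q k c i j _ => ?_⟩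
    · simp only [PosEnc.score, add_right_comm _ _ 1, h]
    · simp only [PosEnc.score, add_right_comm _ _ 1, h, implies_true, and_self]
  | alibi α hα =>
    -- One `D` serves all of the finitely many queries, keys and values. Here `none` stands for the
    -- factor `1` of the denominator, which need not be a fixed-precision number.
    have hfar : ∃ D : ℕ, ∀ m ≥ D, ∀ (a : (Vec p s d × Vec p s d) × (Option (Fixed p s))),
        ∀ m' ≥ D,
        roundDown p s (Real.exp (a.1.1.val ⬝ᵥ a.1.2.val - α * m) * (a.2.elim 1 Fixed.val)) =
        roundDown p s (Real.exp (a.1.1.val ⬝ᵥ a.1.2.val - α * m') * (a.2.elim 1 Fixed.val)) := by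
      choose y hy using fun (a : (Vec p s d × Vec p s d) × (Option (Fixed p s))) =>
        exists_eventually_roundDown_exp_mul_eq p s hα (a.1.1.val ⬝ᵥ a.1.2.val)
          (a.2.elim 1 Fixed.val)
      obtain ⟨D, hD⟩ := Filter.eventually_atTop.1 (Filter.eventually_all.2 hy)
      exact ⟨D, fun m hm a m' hm' => by rw [hD m hm a, hD m' hm' a]⟩
    obtain ⟨D, hD⟩ := hfar
    refine ⟨1, D, one_pos, fun c i => rfl, fun c i j q k => ?_, fun q k c i j hij => ?_⟩
    · simp only [PosEnc.score]
      push_cast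
      congr 2
      ring
    · obtain ⟨m, rfl⟩ : ∃ m, i = m + j := ⟨i - j, by omega⟩
      have e1 : (((m + j + 1 * c + 1 : ℕ) : ℝ) - ((j + 1 : ℕ) : ℝ)) = ((m + c : ℕ) : ℝ) := by
        push_cast; ring
      have e2 : (((m + j + 1 : ℕ) : ℝ) - ((j + 1 : ℕ) : ℝ)) = (m : ℝ) := by
        push_cast; ring
      simp only [PosEnc.score, e1, e2]
      exact ⟨fun v => hD (m + c) (by omega) ((q, k), some v) m (by omega),
        by simpa using hD (m + c) (by omega) ((q, k), none) m (by omega)⟩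

/-! ## Transformers as threshold machines -/

namespace Transformer

variable {κ : PEKind} {Γ : Type} {k : ℕ}

/-- The thresholds that determine the result of an attention layer: whether the denominator
vanishes, and the lower bounds of the coordinates of the weighted and of the uniform average. -/
inductive Test (p s d : ℕ)
  | den
  | weighted (c : Fin d) (y : Fixed p s)
  | uniform (c : Fin d) (y : Fixed p s)

instance (p s d : ℕ) : Finite (Test p s d) :=
  Finite.of_injective (β := Option (Bool × Fin d × Fixed p s))
    (fun t => match t with
      | .den => none
      | .weighted c y => some (true, c, y)
      | .uniform c y => some (false, c, y)) (by
    intro x y h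
    cases x <;> cases y <;> simp_all)

/-- The unrounded attention weight, with zero-based positions. -/
noncomputable def weight (T : Transformer κ Γ k) (ℓ : Fin k) (i j : ℕ) (x y : Vec T.p T.s T.d) : ℝ :=
  Real.exp (T.pe.score T.p T.s (i + 1) (j + 1) (T.WQ ℓ x).val (T.WK ℓ y).val)

/-- The summand of the test `t` at positions `i` and `j`. -/
noncomputable def testScore (T : Transformer κ Γ k) (ℓ : Fin k) (t : Test T.p T.s T.d) (i j : ℕ)
    (x y : Vec T.p T.s T.d) : ℝ :=
  match t with
  | .den => -(roundDown T.p T.s (T.weight ℓ i j x y)).val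
  | .weighted c z => (roundDown T.p T.s (T.weight ℓ i j x y * (T.WV ℓ y c).val)).val -
      z.val * (roundDown T.p T.s (T.weight ℓ i j x y)).val
  | .uniform c z => (T.WV ℓ y c).val - z.val

open Classical in
/-- The result of attention in terms of the results of the tests. -/
noncomputable def decodeTests {p s d : ℕ} (P : Test p s d → Prop) : Vec p s d := fun c =>
  decodeCut p s fun z => if P .den then P (.uniform c z) else P (.weighted c z)

/-- The threshold machine that simulates a transformer. -/
noncomputable def toMachine (T : Transformer κ Γ k) :
    ThresholdMachine Γ (Vec T.p T.s T.d) (Test T.p T.s T.d) where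
  init i x := roundVec T.p T.s ((T.E x).val + T.pe.embedding T.p T.s (i + 1))
  score ℓ t i j x y := if h : ℓ < k then T.testScore ⟨ℓ, h⟩ t i j x y else 0
  update ℓ x P :=
    if h : ℓ < k then
      T.f ⟨ℓ, h⟩ (roundVec T.p T.s ((decodeTests P : Vec T.p T.s T.d).val + x.val))
    else x

theorem sum_Iic_fin {n : ℕ} (i : Fin n) (f : ℕ → ℝ) :
    ∑ j ∈ Finset.Iic i, f j = ∑ j ∈ Finset.range (i + 1), f j := by
  rw [Nat.range_succ_eq_Iic, ← Fin.map_valEmbedding_Iic, Finset.sum_map]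
  rfl

theorem roundDown_nonneg {p s : ℕ} {x : ℝ} (hx : 0 ≤ x) : 0 ≤ (roundDown p s x).val := by
  have h : (0 : ℤ) < 2 ^ (p - 1) := by positivity
  have h1 : 0 ≤ ⌊x * 2 ^ s⌋ := Int.floor_nonneg.2 (by positivity)
  have h2 : 0 ≤ (roundDown p s x).num := by
    simp only [roundDown]; omega
  exact div_nonneg (by exact_mod_cast h2) (by positivity)

/-- Clearing a positive denominator turns each lower bound on the quotient into the sign of a sum
over positions; if it vanishes, `i + 1` takes its place. Rounded weights are nonnegative, so the
test `den` succeeds exactly when the denominator is zero. -/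
theorem attention_eq_decodeTests (T : Transformer κ Γ k) {n : ℕ} (ℓ : Fin k)
    (x : ℕ → Vec T.p T.s T.d) (i : Fin n) :
    T.attention (fun j : Fin n => T.WQ ℓ (x j)) (fun j => T.WK ℓ (x j)) (fun j => T.WV ℓ (x j)) i =
      decodeTests fun t => 0 ≤ ∑ j ∈ Finset.range (i + 1), T.testScore ℓ t i j (x i) (x j) := by
  funext c
  simp only [attention, decodeTests]
  symm
  apply decodeCut_eq
  intro z
  have h1 := sum_Iic_fin i fun j => (roundDown T.p T.s (T.weight ℓ i j (x i) (x j))).val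
  have h2 := sum_Iic_fin i fun j =>
    (roundDown T.p T.s (T.weight ℓ i j (x i) (x j) * (T.WV ℓ (x j) c).val)).val
  have h3 := sum_Iic_fin i fun j => (T.WV ℓ (x j) c).val
  simp only [weight] at h1 h2 h3
  rw [h1, h2, h3]
  simp only [testScore, Finset.sum_neg_distrib, Finset.sum_sub_distrib, ← Finset.mul_sum, weight]
  have hnn : 0 ≤ ∑ j ∈ Finset.range (i.val + 1), (roundDown T.p T.s (Real.exp
      (T.pe.score T.p T.s (i.val + 1) (j + 1) (T.WQ ℓ (x i)).val (T.WK ℓ (x j)).val))).val :=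
    Finset.sum_nonneg fun j _ => roundDown_nonneg (Real.exp_pos _).le
  generalize (∑ j ∈ Finset.range (i.val + 1), (roundDown T.p T.s (Real.exp
      (T.pe.score T.p T.s (i.val + 1) (j + 1) (T.WQ ℓ (x i)).val (T.WK ℓ (x j)).val))).val) = den
    at hnn ⊢
  rcases hnn.eq_or_lt with rfl | hpos
  · rw [if_pos (by simp), if_pos rfl, le_div_iff₀ (by positivity), Finset.sum_const,
      Finset.card_range, nsmul_eq_mul, sub_nonneg]
    push_cast
    rw [mul_comm]
  · rw [if_neg (by linarith), if_neg hpos.ne', le_div_iff₀ hpos, sub_nonneg]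

theorem hidden_eq_run (T : Transformer κ Γ k) (w : List Γ) (w' : ℕ → Γ)
    (hw : ∀ i : Fin w.length, w.get i = w' i) (ℓ : ℕ) (hℓ : ℓ ≤ k) (i : Fin w.length) :
    T.hidden w ℓ hℓ i = T.toMachine.run w' ℓ i := by
  induction ℓ generalizing i with
  | zero => simp only [hidden, ThresholdMachine.run, toMachine, hw]
  | succ ℓ ih =>
    have hlt : ℓ < k := hℓ
    have ih' := ih (Nat.le_of_succ_le hℓ)
    have := T.attention_eq_decodeTests ⟨ℓ, hlt⟩ (T.toMachine.run w' ℓ) i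
    simp only [hidden, ih', this, ThresholdMachine.run]
    simp only [toMachine, hlt, dif_pos]

theorem exists_isPeriodic (T : Transformer κ Γ k) :
    ∃ P D : ℕ, 0 < P ∧ T.toMachine.IsPeriodic P D := by
  obtain ⟨P, D, hP, h1, h2, h3⟩ := exists_roundDown_exp_score_periodic T.p T.s T.pe
  refine ⟨P, D, hP, ⟨fun c i x => congrFun (h1 c i) _, fun c ℓ t i j x y => ?_,
    fun c ℓ t i j x y hij => ?_⟩⟩
  · by_cases h : ℓ < k
    · simp only [toMachine, h, dif_pos]
      cases t <;> simp only [testScore, weight, h2]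
    · simp [toMachine, h]
  · by_cases h : ℓ < k
    · have h4 := h3 (T.WQ ⟨ℓ, h⟩ x) (T.WK ⟨ℓ, h⟩ y) c i j hij
      simp only [toMachine, h, dif_pos]
      cases t with
      | den => simp only [testScore, weight, h4.2]
      | weighted c' z => simp only [testScore, weight, h4.1, h4.2]
      | uniform c' z => rfl
    · simp [toMachine, h]

end Transformer

/-! ## Layered existence tests by transformers -/

/-- A layered computation in which the state of a position in the next layer is determined by its
current state and two existence tests on the positions up to it. -/
structure ExistsMachine (Γ S : Type) where
  init : Γ → S
  test : ℕ → Bool → S → Prop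
  update : ℕ → S → (Bool → Prop) → S

/-- The state of position `i` after `ℓ` layers. -/
def ExistsMachine.run {Γ S : Type} (A : ExistsMachine Γ S) (w : ℕ → Γ) : ℕ → ℕ → S
  | 0, i => A.init (w i)
  | ℓ + 1, i => A.update ℓ (A.run w ℓ i) fun b => ∃ j ≤ i, A.test ℓ b (A.run w ℓ j)

/-- A position encoding of the given kind that does not affect attention. -/
def trivialPosEnc : (κ : PEKind) → PosEnc 6 κ
  | .none => .none
  | .sinusoidal => .sinusoidal (by decide) 0 fun _ => ⟨0, by simp⟩
  | .rope => .rope (by decide) 0 fun _ => ⟨0, by simp⟩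
  | .alibi => .alibi 0 le_rfl

theorem val_roundDown_intCast {p : ℕ} {z : ℤ} (h1 : -2 ^ (p - 1) ≤ z) (h2 : z < 2 ^ (p - 1)) :
    (roundDown p 0 z).val = z := by
  simp only [Fixed.val, roundDown, pow_zero, mul_one, div_one, Int.floor_intCast]
  congr 1
  omega

theorem num_roundDown_zero (p s : ℕ) : (roundDown p s 0).num = 0 := by
  have h : (0 : ℤ) < 2 ^ (p - 1) := by positivity
  simp only [roundDown, zero_mul, Int.floor_zero]
  omega

theorem val_roundDown_zero (p s : ℕ) : (roundDown p s 0).val = 0 := by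
  simp [Fixed.val, num_roundDown_zero]

theorem roundDown_val {p s : ℕ} (y : Fixed p s) : roundDown p s y.val = y := by
  have h1 := y.lower
  have h2 := y.upper
  ext
  simp only [roundDown, Fixed.val, div_mul_cancel₀ _ (by positivity : (2 : ℝ) ^ s ≠ 0),
    Int.floor_intCast]
  omega

theorem trivialPosEnc_score (κ : PEKind) (p s i j : ℕ) :
    (trivialPosEnc κ).score p s i j 0 0 = 0 := by
  cases κ <;> simp [trivialPosEnc, PosEnc.score]

/-- Zero angles leave only `sin 0` at even coordinates, which is why the simulation keeps its data
there. -/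
theorem trivialPosEnc_embedding (κ : PEKind) (p s i : ℕ) {c : Fin 6} (hc : Even c.val) :
    (trivialPosEnc κ).embedding p s i c = 0 := by
  cases κ
  case sinusoidal =>
    have h0 : rotMatrix 6 (0 : ℕ → ℝ) = 1 := rotMatrix_zero 6
    simp only [trivialPosEnc, PosEnc.embedding, rotationPow, h0, one_pow, Matrix.mulVec, dotProduct]
    refine Finset.sum_eq_zero fun j _ => ?_
    by_cases h : c = j
    · subst h; simp [hc]
    · simp [Matrix.one_apply_ne h, val_roundDown_zero]
  all_goals rfl

/-- One term `-1` puts the average into `[-1, 0)` however long the input is, and the floor is `-1`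
on all of this interval. So fixed precision can detect a single position. -/
theorem floor_average_eq (P : ℕ → Prop) [DecidablePred P] (i : ℕ) [Decidable (∃ j ≤ i, P j)] :
    ⌊(∑ j ∈ Finset.range (i + 1), if P j then (-1 : ℝ) else 0) / ((i : ℝ) + 1)⌋ =
      if ∃ j ≤ i, P j then -1 else 0 := by
  have hpos : (0 : ℝ) < (i : ℝ) + 1 := by positivity
  rw [Int.floor_eq_iff]
  split_ifs with h
  · obtain ⟨j, hj, hP⟩ := h
    rw [le_div_iff₀ hpos, div_lt_iff₀ hpos]
    constructor
    · have : ∑ j ∈ Finset.range (i + 1), (-1 : ℝ) ≤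
          ∑ j ∈ Finset.range (i + 1), if P j then (-1 : ℝ) else 0 :=
        Finset.sum_le_sum fun j _ => by split_ifs <;> norm_num
      simpa using this
    · have : ∑ j ∈ Finset.range (i + 1), (if P j then (-1 : ℝ) else 0) <
          ∑ j ∈ Finset.range (i + 1), (0 : ℝ) :=
        Finset.sum_lt_sum (fun j _ => by split_ifs <;> norm_num)
          ⟨j, Finset.mem_range.2 (by omega), by simp [hP]⟩
      simpa using this
  · push Not at h
    have : ∑ j ∈ Finset.range (i + 1), (if P j then (-1 : ℝ) else 0) = 0 :=
      Finset.sum_eq_zero fun j hj => by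
        rw [if_neg (h j (Nat.lt_succ_iff.1 (Finset.mem_range.1 hj)))]
    simp [this]

/-! ### Simulating existence tests by uniform attention -/

namespace ExistsMachine

variable {Γ S : Type} [Fintype S]

/-- The number of bits used to encode states. -/
def bits (S : Type) [Fintype S] : ℕ := Fintype.card S + 2

theorem card_lt_bits (S : Type) [Fintype S] : (Fintype.card S : ℤ) < 2 ^ (bits S - 1) := by
  have h1 : Fintype.card S < 2 ^ Fintype.card S := Nat.lt_two_pow_self
  have h2 : 2 ^ Fintype.card S ≤ 2 ^ (bits S - 1) := Nat.pow_le_pow_right two_pos (by simp [bits])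
  exact_mod_cast h1.trans_le h2

/-- States as fixed-precision numbers. -/
noncomputable def encode (x : S) : Fixed (bits S) 0 where
  num := (Fintype.equivFin S x).val
  lower := by
    have h : (0 : ℤ) < 2 ^ (bits S - 1) := by positivity
    omega
  upper := by
    have := card_lt_bits S
    have := (Fintype.equivFin S x).isLt
    omega

theorem encode_injective : Function.Injective (encode : S → Fixed (bits S) 0) := by
  intro x y h
  have := congrArg Fixed.num h
  simp only [encode, Nat.cast_inj] at this
  exact (Fintype.equivFin S).injective (Fin.ext this)

theorem one_lt_two_pow_bits (S : Type) [Fintype S] : (1 : ℤ) < 2 ^ (bits S - 1) := by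
  have : bits S - 1 = Fintype.card S + 1 := by simp [bits]
  rw [this, pow_succ]
  have : (0 : ℤ) < 2 ^ Fintype.card S := by positivity
  omega

theorem val_roundDown_one : (roundDown (bits S) 0 1).val = 1 := by
  have h := one_lt_two_pow_bits S
  have := val_roundDown_intCast (p := bits S) (z := 1) (by omega) h
  simpa using this

theorem val_roundDown_ite_neg_one (P : Prop) [Decidable P] :
    (roundDown (bits S) 0 (if P then -1 else 0)).val = if P then -1 else 0 := by
  have h := one_lt_two_pow_bits S
  split_ifs
  · have := val_roundDown_intCast (p := bits S) (z := -1) (by omega) (by omega)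
    simpa using this
  · exact val_roundDown_zero _ _

variable [Nonempty S]

/-- Recovers a state from its code. -/
noncomputable def decode : Fixed (bits S) 0 → S := Function.invFun encode

theorem decode_encode (x : S) : decode (encode x) = x :=
  Function.leftInverse_invFun encode_injective x

/-- The coordinate that receives the result of a test. -/
def testCoord : Bool → Fin 6
  | true => 2
  | false => 4

open Classical in
/-- A transformer that simulates `A` and accepts if the final state satisfies `out`. -/
noncomputable def toTransformer (A : ExistsMachine Γ S) (out : S → Prop) (κ : PEKind) (k : ℕ) :
    Transformer κ Γ k where
  p := bits S
  p_pos := by simp [bits]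
  s := 0
  d := 6
  pe := trivialPosEnc κ
  E x c := if c = 0 then encode (A.init x) else roundDown _ _ 0
  WQ _ _ _ := roundDown _ _ 0
  WK _ _ _ := roundDown _ _ 0
  WV ℓ h c := roundDown _ _ (if ∃ b, c = testCoord b ∧ A.test ℓ b (decode (h 0)) then -1 else 0)
  f ℓ h c := if c = 0 then encode (A.update ℓ (decode (h 0)) fun b => (h (testCoord b)).num < 0)
    else roundDown _ _ 0
  Wout h := roundDown _ _ (if out (decode (h 0)) then 1 else 0)

/-- The hidden vectors of the simulating transformer. -/
noncomputable def simHidden (A : ExistsMachine Γ S) (out : S → Prop) (κ : PEKind) (k : ℕ)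
    (w : List Γ) (ℓ : ℕ) (hℓ : ℓ ≤ k) (i : Fin w.length) : Vec (bits S) 0 6 :=
  (A.toTransformer out κ k).hidden w ℓ hℓ i

/-- The attention vectors of the simulating transformer on given hidden vectors. -/
noncomputable def simAttention (A : ExistsMachine Γ S) (out : S → Prop) (κ : PEKind) (k : ℕ)
    (ℓ : Fin k) {n : ℕ} (h : Fin n → Vec (bits S) 0 6) : Fin n → Vec (bits S) 0 6 :=
  (A.toTransformer out κ k).attention (fun j => (A.toTransformer out κ k).WQ ℓ (h j))
    (fun j => (A.toTransformer out κ k).WK ℓ (h j)) (fun j => (A.toTransformer out κ k).WV ℓ (h j))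

-- Queries and keys are zero, so all weights are `1`, the denominator is `i + 1`, and attention is a
-- uniform average.
open Classical in
theorem num_simAttention (A : ExistsMachine Γ S) (out : S → Prop) (κ : PEKind) (k : ℕ)
    (ℓ : Fin k) {n : ℕ} (h : Fin n → Vec (bits S) 0 6) (x : ℕ → S)
    (hx : ∀ j, h j 0 = encode (x j)) (i : Fin n) (c : Fin 6) :
    (A.simAttention out κ k ℓ h i c).num =
    if ∃ j ≤ i.val, ∃ b, c = testCoord b ∧ A.test ℓ b (x j) then -1 else 0 := by
  have hz : Vec.val (fun _ => roundDown (bits S) 0 0 : Vec (bits S) 0 6) = 0 := by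
    funext c
    exact val_roundDown_zero _ _
  simp only [simAttention, Transformer.attention, toTransformer, hx, decode_encode]
  erw [hz]
  simp only [trivialPosEnc_score, Real.exp_zero, one_mul,
    val_roundDown_one, val_roundDown_ite_neg_one,
    Finset.sum_const, Fin.card_Iic, nsmul_eq_mul, mul_one]
  rw [if_neg (by positivity), Transformer.sum_Iic_fin i fun j =>
    if ∃ b, c = testCoord b ∧ A.test ℓ b (x j) then (-1 : ℝ) else 0]
  have := floor_average_eq (fun j => ∃ b, c = testCoord b ∧ A.test ℓ b (x j)) i.val
  simp only [roundDown, pow_zero, mul_one, Nat.cast_add, Nat.cast_one, this]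
  have h1 := one_lt_two_pow_bits S
  split_ifs <;> omega

theorem roundDown_add_of_num_eq_zero {p s : ℕ} {x : Fixed p s} (h : x.num = 0) (y : Fixed p s) :
    roundDown p s (x.val + y.val) = y := by
  rw [Fixed.val, h]
  simp [roundDown_val]

theorem roundDown_add_of_num_eq_zero' {p s : ℕ} {y : Fixed p s} (h : y.num = 0) (x : Fixed p s) :
    roundDown p s (x.val + y.val) = x := by
  rw [add_comm, roundDown_add_of_num_eq_zero h]

theorem testCoord_injective : Function.Injective testCoord := by decide

theorem testCoord_ne_zero (b : Bool) : testCoord b ≠ 0 := by revert b; decide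

theorem simHidden_zero (A : ExistsMachine Γ S) (out : S → Prop) (κ : PEKind) (k : ℕ)
    (w : List Γ) (hℓ : 0 ≤ k) (i : Fin w.length) {c : Fin 6} (hc : Even c.val) :
    A.simHidden out κ k w 0 hℓ i c =
      if c = 0 then encode (A.init (w.get i)) else roundDown _ _ 0 := by
  have h : A.simHidden out κ k w 0 hℓ i c = roundDown (bits S) 0
      ((if c = 0 then encode (A.init (w.get i)) else roundDown _ _ 0 : Fixed (bits S) 0).val +
        (trivialPosEnc κ).embedding (bits S) 0 (i.val + 1) c) := rfl
  rw [h, trivialPosEnc_embedding κ _ _ _ hc, add_zero, roundDown_val]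

open Classical in
theorem simHidden_succ (A : ExistsMachine Γ S) (out : S → Prop) (κ : PEKind) (k : ℕ)
    (w : List Γ) (ℓ : ℕ) (hℓ : ℓ + 1 ≤ k) (i : Fin w.length) (c : Fin 6) :
    let h := A.simHidden out κ k w ℓ (Nat.le_of_succ_le hℓ)
    let y := fun c => roundDown (bits S) 0
      ((A.simAttention out κ k ⟨ℓ, hℓ⟩ h i c).val + (h i c).val)
    A.simHidden out κ k w (ℓ + 1) hℓ i c =
      if c = 0 then encode (A.update ℓ (decode (y 0)) fun b => (y (testCoord b)).num < 0)
      else roundDown _ _ 0 := rfl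

/-- Attention adds zero to the state coordinate, and `f` resets the test coordinates to zero. So the
residual sum keeps state and test results apart, and its rounding loses nothing. -/
theorem simHidden_eq (A : ExistsMachine Γ S) (out : S → Prop) (κ : PEKind) (k : ℕ)
    (w : List Γ) (w' : ℕ → Γ) (hw : ∀ i : Fin w.length, w.get i = w' i) (ℓ : ℕ) (hℓ : ℓ ≤ k)
    (i : Fin w.length) :
    A.simHidden out κ k w ℓ hℓ i 0 = encode (A.run w' ℓ i) ∧
      ∀ b, (A.simHidden out κ k w ℓ hℓ i (testCoord b)).num = 0 := by
  induction ℓ generalizing i with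
  | zero =>
    refine ⟨?_, fun b => ?_⟩
    · rw [simHidden_zero _ _ _ _ _ _ _ (by decide), if_pos rfl, hw, run]
    · rw [simHidden_zero _ _ _ _ _ _ _ (by cases b <;> decide), if_neg (testCoord_ne_zero b),
        num_roundDown_zero]
  | succ ℓ ih =>
    have ih' := ih (Nat.le_of_succ_le hℓ)
    have hatt := num_simAttention A out κ k ⟨ℓ, hℓ⟩
      (A.simHidden out κ k w ℓ (Nat.le_of_succ_le hℓ)) (A.run w' ℓ) (fun j => (ih' j).1) i
    refine ⟨?_, fun b => ?_⟩
    · rw [simHidden_succ, if_pos rfl, run]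
      congr 2
      · beta_reduce
        rw [roundDown_add_of_num_eq_zero, (ih' i).1, decode_encode]
        rw [hatt, if_neg]
        rintro ⟨j, -, b, h, -⟩
        exact testCoord_ne_zero b h.symm
      · funext b
        have h2 : ∀ j, (∃ b', testCoord b = testCoord b' ∧
            A.test ℓ b' (A.run w' ℓ j)) ↔ A.test ℓ b (A.run w' ℓ j) := fun j =>
          ⟨fun ⟨b', h, h'⟩ => testCoord_injective h ▸ h', fun h => ⟨b, rfl, h⟩⟩
        beta_reduce
        rw [roundDown_add_of_num_eq_zero' ((ih' i).2 b), hatt]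
        have h3 : (∃ j ≤ i.val, ∃ b', testCoord b = testCoord b' ∧ A.test ℓ b' (A.run w' ℓ j)) ↔
            ∃ j ≤ i.val, A.test ℓ b (A.run w' ℓ j) :=
          exists_congr fun j => and_congr_right fun _ => h2 j
        rw [← h3]
        split_ifs with h
        · exact propext ⟨fun _ => h, fun _ => by norm_num⟩
        · exact propext ⟨fun h' => absurd h' (lt_irrefl _), fun h' => absurd h' h⟩
    · rw [simHidden_succ, if_neg (testCoord_ne_zero b), num_roundDown_zero]

theorem accepts_toTransformer (A : ExistsMachine Γ S) (out : S → Prop) (κ : PEKind) (k : ℕ)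
    (w : List Γ) (hne : w ≠ []) (w' : ℕ → Γ) (hw : ∀ i : Fin w.length, w.get i = w' i) :
    (A.toTransformer out κ k).Accepts w hne ↔ out (A.run w' k (w.length - 1)) := by
  classical
  have h := (simHidden_eq A out κ k w w' hw k le_rfl
    ⟨w.length - 1, Nat.sub_lt (List.length_pos_of_ne_nil hne) one_pos⟩).1
  have hout : (A.toTransformer out κ k).output w hne = roundDown (bits S) 0
    (if out (decode (A.simHidden out κ k w k le_rfl
    ⟨w.length - 1, Nat.sub_lt (List.length_pos_of_ne_nil hne) one_pos⟩ 0)) then 1 else 0) := by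
    unfold Transformer.output simHidden toTransformer
    congr!
  rw [Transformer.Accepts, hout, h, decode_encode]
  change 0 < Fixed.val (p := bits S) (s := 0) _ ↔ _
  split_ifs with h'
  · simp [val_roundDown_one, h']
  · simp [val_roundDown_zero, h']

end ExistsMachine

/-! ## Counting blocks by existence tests -/

/-- The letter of `{a, b}` in an input symbol, if there is one. -/
def letterOf : WithBOS ABE → Option AB
  | .sym (.letter x) => some x
  | _ => none

/-- The letters of `{a, b}` before position `m`. -/
def lettersBefore (w : ℕ → WithBOS ABE) : ℕ → List AB
  | 0 => []
  | m + 1 => lettersBefore w m ++ (letterOf (w m)).toList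

theorem lettersBefore_congr {w w' : ℕ → WithBOS ABE} {m : ℕ} (h : ∀ i < m, w i = w' i) :
    lettersBefore w m = lettersBefore w' m := by
  induction m with
  | zero => rfl
  | succ m ih =>
    rw [lettersBefore, lettersBefore, ih fun i hi => h i (by omega), h m (by omega)]

theorem lettersBefore_input (u : List ABE) :
    lettersBefore (fun i => (WithBOS.bos :: u.map WithBOS.sym).getD i WithBOS.bos) (u.length + 1) =
      del u := by
  induction u using List.reverseRecOn with
  | nil => rfl
  | append_singleton u x ih =>
    rw [List.length_append, List.length_singleton, lettersBefore, del_append, ← ih]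
    congr 1
    · refine lettersBefore_congr fun i hi => ?_
      rw [List.map_append, ← List.cons_append, List.getD_append]
      simpa using hi
    · rcases x with x | _ <;> simp [letterOf, del]

theorem mem_lettersBefore (w : ℕ → WithBOS ABE) (m : ℕ) (x : AB) :
    x ∈ lettersBefore w m ↔ ∃ j < m, letterOf (w j) = some x := by
  induction m with
  | zero => simp [lettersBefore]
  | succ m ih =>
    simp only [lettersBefore, List.mem_append, ih, Option.mem_toList,
      Nat.lt_succ_iff_lt_or_eq, or_and_right, exists_or, exists_eq_left]

theorem lettersBefore_prefix (w : ℕ → WithBOS ABE) {m n : ℕ} (h : m ≤ n) :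
    lettersBefore w m <+: lettersBefore w n := by
  induction n, h using Nat.le_induction with
  | base => exact List.prefix_refl _
  | succ n _ ih => exact ih.trans (List.prefix_append _ _)

theorem head?_lettersBefore (w : ℕ → WithBOS ABE) {m n : ℕ} (h : m ≤ n) {x : AB}
    (hx : (lettersBefore w m).head? = some x) : (lettersBefore w n).head? = some x := by
  obtain ⟨t, ht⟩ := lettersBefore_prefix w h
  rw [← ht, List.head?_append, hx]
  rfl

theorem blockStep_eq_self_or (q : ℕ) (x : AB) : blockStep q x = q ∧ x = blockLetter q ∨
    blockStep q x = q + 1 ∧ x = blockLetter (q + 1) := by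
  rcases eq_blockLetter_or q x with rfl | rfl
  · exact Or.inl ⟨blockStep_blockLetter _, rfl⟩
  · exact Or.inr ⟨blockStep_blockLetter_succ _, rfl⟩

/-- There are more than `q` blocks if and only if the letter of block `q + 1` occurs in or after
block `q`. -/
theorem lt_blockCount_lettersBefore (w : ℕ → WithBOS ABE) (q m : ℕ) :
    q < blockCount (lettersBefore w m) ↔ ∃ j < m, q ≤ blockCount (lettersBefore w (j + 1)) ∧
      letterOf (w j) = some (blockLetter (q + 1)) := by
  induction m with
  | zero => simp [lettersBefore, blockCount]
  | succ m ih =>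
    simp only [Nat.lt_succ_iff_lt_or_eq (n := m), or_and_right, exists_or, exists_eq_left, ← ih]
    rw [lettersBefore]
    cases hx : letterOf (w m) with
    | none => simp
    | some x =>
      rw [Option.toList_some, blockCount_append_singleton]
      rcases blockStep_eq_self_or (blockCount (lettersBefore w m)) x with ⟨h1, h2⟩ | ⟨h1, h2⟩
      · rw [h1, h2]
        constructor
        · exact Or.inl
        · rintro (h | ⟨h3, h4⟩)
          · exact h
          · rcases h3.lt_or_eq with h5 | h5
            · exact h5
            · rw [h5, Option.some.injEq] at h4
              exact absurd h4 (blockLetter_ne_succ _)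
      · rw [h1, h2]
        constructor
        · intro h
          rcases (Nat.lt_succ_iff.1 h).lt_or_eq with h5 | h5
          · exact Or.inl h5
          · exact Or.inr ⟨by omega, by rw [h5]⟩
        · rintro (h | ⟨h3, h4⟩)
          · omega
          · rcases h3.lt_or_eq with h5 | h5
            · exact h5
            · rw [h5, Option.some.injEq] at h4
              exact absurd h4 (blockLetter_ne_succ _)

/-- The state of a position: its letter, the number of blocks so far up to a bound, and whether
the first letter is known to be `b`. -/
abbrev BlockState (K : ℕ) : Type := Option AB × Fin (K + 2) × Bool

instance : DecidableEq AB
  | .a, .a => isTrue rfl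
  | .a, .b => isFalse (by simp)
  | .b, .a => isFalse (by simp)
  | .b, .b => isTrue rfl

instance : Fintype AB where
  elems := {AB.a, AB.b}
  complete x := by cases x <;> simp

open Classical in
/-- The computation of the number of blocks, up to `ℓ + 1` in layer `ℓ`. -/
noncomputable def blockMachine (K : ℕ) : ExistsMachine (WithBOS ABE) (BlockState K) where
  init x := (letterOf x, 0, false)
  test ℓ b x :=
    if ℓ = 0 then x.1 = some (if b then AB.a else AB.b)
    else if b then x.2.1.val = ℓ + 1 ∧ x.1 = some (blockLetter (ℓ + 2)) else x.2.2 = true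
  update ℓ x P :=
    if ℓ = 0 then
      (x.1, Fin.ofNat (K + 2) (if P true then (if P false then 2 else 1) else 0),
        decide (P false ∧ ¬ P true))
    else (x.1, if P true then Fin.ofNat (K + 2) (ℓ + 2) else x.2.1, decide (P false))

theorem blockMachine_letter (K : ℕ) (w : ℕ → WithBOS ABE) (ℓ i : ℕ) :
    ((blockMachine K).run w ℓ i).1 = letterOf (w i) := by
  induction ℓ with
  | zero => rfl
  | succ ℓ ih =>
    rw [ExistsMachine.run, ← ih]
    simp only [blockMachine]
    split_ifs <;> rfl

theorem blockMachine_run_one (K : ℕ) (w : ℕ → WithBOS ABE) (i : ℕ) :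
    (((blockMachine (K + 1)).run w 1 i).2.1.val =
      if AB.a ∈ lettersBefore w (i + 1) then (if AB.b ∈ lettersBefore w (i + 1) then 2 else 1)
      else 0) ∧
    (((blockMachine (K + 1)).run w 1 i).2.2 = true ↔
      AB.b ∈ lettersBefore w (i + 1) ∧ AB.a ∉ lettersBefore w (i + 1)) := by
  have h : ∀ x : AB, (∃ j ≤ i, ((blockMachine (K + 1)).run w 0 j).1 = some x) ↔
      x ∈ lettersBefore w (i + 1) := by
    intro x
    simp only [blockMachine_letter, mem_lettersBefore, Nat.lt_succ_iff]
  rw [ExistsMachine.run]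
  have ha := h AB.a
  have hb := h AB.b
  generalize (blockMachine (K + 1)).run w 0 = run at *
  simp only [blockMachine, if_true, ha, hb, Bool.false_eq_true, if_false, decide_eq_true_eq,
    and_true, Fin.val_ofNat]
  have h3 : 2 % (K + 1 + 2) = 2 := Nat.mod_eq_of_lt (by omega)
  have h2 : 1 % (K + 1 + 2) = 1 := Nat.mod_eq_of_lt (by omega)
  split_ifs <;> simp [h2, h3]

theorem head?_cases (u : List AB) :
    u = [] ∨ u.head? = some AB.a ∨ u.head? = some AB.b := by
  cases u with
  | nil => exact Or.inl rfl
  | cons x u => cases x <;> simp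

/-- On strings that do not start with `b`, the machine counts blocks correctly. -/
theorem blockMachine_run_of_head (K : ℕ) (w : ℕ → WithBOS ABE) (m : ℕ)
    (hm : (lettersBefore w m).head? ≠ some AB.b) (ℓ : ℕ) (hℓ : ℓ ≤ K) (i : ℕ) (hi : i < m) :
    ((blockMachine (K + 1)).run w (ℓ + 1) i).2.1.val =
        min (blockCount (lettersBefore w (i + 1))) (ℓ + 2) ∧
      ((blockMachine (K + 1)).run w (ℓ + 1) i).2.2 = false := by
  have hhead : ∀ j < m, lettersBefore w (j + 1) = [] ∨
      (lettersBefore w (j + 1)).head? = some AB.a := by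
    intro j hj
    rcases head?_cases (lettersBefore w (j + 1)) with h | h | h
    · exact Or.inl h
    · exact Or.inr h
    · exact absurd (head?_lettersBefore w hj h) hm
  induction ℓ generalizing i with
  | zero =>
    obtain ⟨h1, h2⟩ := blockMachine_run_one K w i
    have ha : AB.a ∈ lettersBefore w (i + 1) ↔ 0 < blockCount (lettersBefore w (i + 1)) := by
      rw [lt_blockCount_lettersBefore, mem_lettersBefore]
      simp [blockLetter]
    -- As the string does not start with `b`, every `b` follows some `a`. Hence one layer already
    -- counts two blocks.
    have hb : AB.b ∈ lettersBefore w (i + 1) ↔ 1 < blockCount (lettersBefore w (i + 1)) := by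
      rw [lt_blockCount_lettersBefore, mem_lettersBefore]
      have : blockLetter (1 + 1) = AB.b := by simp [blockLetter]
      simp only [this]
      refine exists_congr fun j => and_congr_right fun hj => ?_
      refine ⟨fun h => ⟨?_, h⟩, And.right⟩
      rcases hhead j (by omega) with h3 | h3
      · simp [lettersBefore, h] at h3
      · exact blockCount_pos_of_head h3
    rw [zero_add, h1]
    refine ⟨?_, ?_⟩
    · simp only [ha, hb]
      split_ifs <;> omega
    · rw [← Bool.not_eq_true, h2, ha, hb]
      omega
  | succ ℓ ih =>
    have ihi := ih (by omega)
    have htest : (∃ j ≤ i, ((blockMachine (K + 1)).run w (ℓ + 1) j).2.1.val = ℓ + 1 + 1 ∧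
        ((blockMachine (K + 1)).run w (ℓ + 1) j).1 = some (blockLetter (ℓ + 1 + 2))) ↔
        ℓ + 2 < blockCount (lettersBefore w (i + 1)) := by
      rw [lt_blockCount_lettersBefore]
      refine exists_congr fun j => ?_
      rw [Nat.lt_succ_iff]
      refine and_congr_right fun hj => ?_
      -- A count capped at `ℓ + 2` equals its cap exactly when the true count is at least `ℓ + 2`.
      rw [(ihi j (by omega)).1, blockMachine_letter]
      exact and_congr (by omega) Iff.rfl
    have hsb : ¬ ∃ j ≤ i, ((blockMachine (K + 1)).run w (ℓ + 1) j).2.2 = true := by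
      rintro ⟨j, hj, h⟩
      rw [(ihi j (by omega)).2] at h
      exact Bool.false_ne_true h
    have hi1 := (ihi i hi).1
    rw [ExistsMachine.run]
    generalize (blockMachine (K + 1)).run w (ℓ + 1) = run at *
    simp only [blockMachine, Nat.add_eq_zero_iff, one_ne_zero, and_false, if_false, if_true, htest,
      Bool.false_eq_true, hsb, decide_false, and_true]
    split_ifs with h
    · rw [Fin.val_ofNat, Nat.mod_eq_of_lt (by omega)]
      omega
    · omega

/-- On strings that start with `b`, this is detected from the second layer on. -/
theorem blockMachine_run_of_head_b (K : ℕ) (w : ℕ → WithBOS ABE) (m : ℕ)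
    (hm : (lettersBefore w (m + 1)).head? = some AB.b) (ℓ : ℕ) :
    ((blockMachine (K + 1)).run w (ℓ + 2) m).2.2 = true := by
  -- At the first letter no `a` has occurred, so the first layer raises the flag there; the second
  -- hands it to all later positions.
  have hex : ∃ j ≤ m, lettersBefore w (j + 1) = [AB.b] := by
    induction m with
    | zero =>
      refine ⟨0, le_rfl, ?_⟩
      simp only [lettersBefore, List.nil_append] at hm ⊢
      cases h : letterOf (w 0) with
      | none => simp [h] at hm
      | some x => simpa [h] using hm
    | succ m ih =>
      rcases head?_cases (lettersBefore w (m + 1)) with h | h | h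
      · refine ⟨m + 1, le_rfl, ?_⟩
        rw [lettersBefore, h] at hm ⊢
        cases h : letterOf (w (m + 1)) with
        | none => simp [h] at hm
        | some x => simpa [h] using hm
      · rw [head?_lettersBefore w (Nat.le_succ _) h] at hm
        simp at hm
      · obtain ⟨j, hj, h'⟩ := ih h
        exact ⟨j, by omega, h'⟩
  obtain ⟨j, hj, hw⟩ := hex
  have key : ∀ ℓ i, j ≤ i → (∃ j ≤ i, ((blockMachine (K + 1)).run w (ℓ + 1) j).2.2 = true) →
      ((blockMachine (K + 1)).run w (ℓ + 2) i).2.2 = true := by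
    intro ℓ i _ h
    rw [ExistsMachine.run]
    generalize (blockMachine (K + 1)).run w (ℓ + 1) = run at *
    simp only [blockMachine, Nat.add_eq_zero_iff, one_ne_zero, and_false, if_false,
      Bool.false_eq_true, decide_eq_true_eq]
    exact h
  have hj' : ((blockMachine (K + 1)).run w (ℓ + 1) j).2.2 = true := by
    induction ℓ with
    | zero =>
      rw [zero_add, (blockMachine_run_one K w j).2, hw]
      simp
    | succ ℓ ih => exact key ℓ j le_rfl ⟨j, le_rfl, ih⟩
  exact key ℓ m hj ⟨j, hj, hj'⟩

theorem exists_recognizes (κ : PEKind) (k : ℕ) :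
    ∃ T : Transformer κ (WithBOS ABE) (k + 1), T.Recognizes (altPlusNeutral (k + 1)) := by
  refine ⟨(blockMachine (k + 1)).toTransformer (fun x => x.2.1.val = k + 1 ∧ x.2.2 = false)
    κ (k + 1), fun u => ?_⟩
  set w' : ℕ → WithBOS ABE :=
    fun i => (WithBOS.bos :: u.map WithBOS.sym).getD i WithBOS.bos with hw'
  rw [ExistsMachine.accepts_toTransformer _ _ _ _ _ _ w' (fun i => by
      simp only [hw']; rw [List.getD_eq_getElem _ _ i.isLt]; rfl), mem_altPlusNeutral_iff]
  have hdel : lettersBefore w' (u.length + 1) = del u := lettersBefore_input u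
  have hlen : (WithBOS.bos :: u.map WithBOS.sym).length - 1 = u.length := by simp
  rw [hlen, ← hdel]
  by_cases hb : (lettersBefore w' (u.length + 1)).head? = some AB.b
  · simp only [hb, ne_eq, not_true, and_false, iff_false, not_and, Bool.not_eq_false]
    cases k with
    | zero =>
      -- A single layer cannot spread the flag, but since `b` occurs the count is `0` or `2`, never
      -- `1`.
      have h := blockMachine_run_one 0 w' u.length
      have hmem : AB.b ∈ lettersBefore w' (u.length + 1) := List.mem_of_mem_head? hb
      intro h1
      rw [zero_add] at h1
      rw [h.1] at h1
      simp only [hmem, if_true] at h1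
      split_ifs at h1; omega
    | succ k => exact fun _ => blockMachine_run_of_head_b _ _ _ hb k
  · obtain ⟨h1, h2⟩ := blockMachine_run_of_head k w' _ hb k le_rfl u.length (Nat.lt_succ_self _)
    rw [h1, h2]
    simp only [ne_eq, hb, not_false_eq_true, and_true]
    omega

/-! ## The lower bound -/

/-- The finite string of which `padded` is the continuation by `e`s, without `BOS`. -/
def paddedTail (M : ℕ) (L : List ABE) : List ABE :=
  List.replicate M ABE.e ++ L.flatMap fun x => x :: List.replicate M ABE.e

theorem paddedTail_append_singleton (M : ℕ) (L : List ABE) (x : ABE) :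
    paddedTail M (L ++ [x]) = paddedTail M L ++ x :: List.replicate M ABE.e := by
  simp [paddedTail]

theorem length_paddedTail (M : ℕ) (L : List ABE) :
    (paddedTail M L).length + 1 = (L.length + 1) * (M + 1) := by
  induction L using List.reverseRecOn with
  | nil => simp [paddedTail]
  | append_singleton L x ih =>
    rw [paddedTail_append_singleton, List.length_append, List.length_append, List.length_cons,
      List.length_replicate, List.length_singleton, Nat.succ_mul (L.length + 1), ← ih]
    ring

theorem del_paddedTail (M : ℕ) (L : List ABE) : del (paddedTail M L) = del L := by
  induction L using List.reverseRecOn with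
  | nil => simp [paddedTail, ThresholdMachine.del_replicate_e]; rfl
  | append_singleton L x ih =>
    rw [paddedTail_append_singleton, del_append, del_append, ih, ← List.singleton_append,
      del_append, ThresholdMachine.del_replicate_e, List.append_nil]

theorem getD_paddedTail (M : ℕ) (L : List ABE) {i : ℕ} (hi : i < (L.length + 1) * (M + 1)) :
    (WithBOS.bos :: (paddedTail M L).map WithBOS.sym).getD i WithBOS.bos =
      padded (M + 1) L i := by
  induction L using List.reverseRecOn with
  | nil =>
    simp only [List.length_nil, zero_add, one_mul] at hi
    cases i with
    | zero => simp [padded]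
    | succ i =>
      have h : (i + 1) % (M + 1) ≠ 0 := by rw [Nat.mod_eq_of_lt hi]; omega
      have hi' : i < M := by omega
      simp [padded, h, paddedTail, hi']
  | append_singleton L x ih =>
    rcases lt_or_ge i ((L.length + 1) * (M + 1)) with h | h
    · rw [padded_append _ _ h, ← ih h, paddedTail_append_singleton, List.map_append,
        ← List.cons_append, List.getD_append]
      rw [List.length_cons, List.length_map, length_paddedTail]
      exact h
    · obtain ⟨r, rfl⟩ := Nat.exists_eq_add_of_le h
      have hr : r < M + 1 := by
        rw [List.length_append, List.length_singleton, Nat.succ_mul (L.length + 1)] at hi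
        omega
      rw [padded_last L x ⟨r, hr⟩, paddedTail_append_singleton, List.map_append,
        ← List.cons_append, List.getD_append_right]
      · rw [List.length_cons, List.length_map, length_paddedTail, Nat.add_sub_cancel_left]
        cases r with
        | zero => simp
        | succ r =>
          have hr' : r < M := by omega
          simp [hr']
      · rw [List.length_cons, List.length_map, length_paddedTail]
        exact h

/-- After a settled prefix with `k + 1` blocks, `e` and the letter of block `k + 2` lead to the same
state at the end of their padding, but only `e` stays in the language. -/
theorem not_exists_recognizes (κ : PEKind) (k : ℕ) :
    ¬ ∃ T : Transformer κ (WithBOS ABE) k, T.Recognizes (altPlusNeutral (k + 1)) := by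
  rintro ⟨T, hT⟩
  obtain ⟨P, D, hP, hper⟩ := T.exists_isPeriodic
  -- The padded length is a multiple of the period, and the factor `k * D + 2` puts the last offset
  -- `M` beyond `k * D`, where the state has forgotten its letter.
  obtain ⟨M, hM⟩ : ∃ M, P * (k * D + 2) = M + 1 := ⟨P * (k * D + 2) - 1, by
    have : 0 < P * (k * D + 2) := by positivity
    omega⟩
  have hper' := hper.mul (k * D + 2)
  rw [hM] at hper'
  have hkD : k * D + 2 ≤ M + 1 := by rw [← hM]; exact Nat.le_mul_of_pos_left _ hP
  obtain ⟨p, τ, hcount, hhead, hset, htail⟩ :=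
    ThresholdMachine.exists_settled hper' k (by omega) 0
  have hout : ∀ x, T.output (WithBOS.bos :: (paddedTail M (p ++ [x])).map WithBOS.sym)
      (List.cons_ne_nil _ _) = T.Wout (τ x (Fin.last M)) := by
    intro x
    have h := hset [] (by simp) x (Fin.last M)
    have hl := length_paddedTail M (p ++ [x])
    have hlast : (WithBOS.bos :: (paddedTail M (p ++ [x])).map WithBOS.sym).length - 1 =
        (p.length + ([] : List ABE).length + 1) * (M + 1) + (Fin.last M).val := by
      rw [List.length_append, List.length_singleton, Nat.succ_mul (p.length + 1)] at hl
      simp only [List.length_cons, List.length_map, Nat.add_sub_cancel, List.length_nil, add_zero,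
        Fin.val_last]
      omega
    rw [Transformer.output, T.hidden_eq_run _ (padded (M + 1) (p ++ [x]))]
    · simp only [hlast]
      rw [← h]
      simp
    · intro i
      rw [← getD_paddedTail, List.getD_eq_getElem _ _ i.isLt]
      · rfl
      · have := i.isLt
        have hc := List.length_cons (a := WithBOS.bos)
          (as := (paddedTail M (p ++ [x])).map (WithBOS.sym (Γ := ABE)))
        rw [List.length_map, hl] at hc
        exact this.trans_eq hc
  have hmem : ∀ x, 0 < (T.Wout (τ x (Fin.last M))).val ↔
      blockCount (del p ++ del [x]) = k + 1 := by
    intro x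
    rw [← hout x]
    refine (hT (paddedTail M (p ++ [x]))).trans ?_
    rw [mem_altPlusNeutral_iff, del_paddedTail, del_append]
    refine and_iff_left ?_
    rw [List.head?_append, hhead]
    simp
  have h1 := hmem ABE.e
  have h2 := hmem (ABE.letter (blockLetter (k + 1 + 1)))
  rw [htail _ ABE.e _ (by rw [Fin.val_last]; omega), h1] at h2
  have e1 : del [ABE.e] = [] := rfl
  have e2 : ∀ y, del [ABE.letter y] = [y] := fun _ => rfl
  rw [e1, e2, List.append_nil, blockCount_append_singleton, hcount,
    blockStep_blockLetter_succ] at h2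
  omega

end DepthHierarchy

theorem mainTheorem6 (κ : DepthHierarchy.PEKind) (k : ℕ) :
    (∃ T : DepthHierarchy.Transformer κ (DepthHierarchy.WithBOS DepthHierarchy.ABE) (k + 1),
      T.Recognizes (DepthHierarchy.altPlusNeutral (k + 1))) ∧
    ¬ ∃ T : DepthHierarchy.Transformer κ (DepthHierarchy.WithBOS DepthHierarchy.ABE) k,
      T.Recognizes (DepthHierarchy.altPlusNeutral (k + 1)) :=
  ⟨DepthHierarchy.exists_recognizes κ k, DepthHierarchy.not_exists_recognizes κ k⟩
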